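/- Fix $\alpha\in(0,1)$. On a probability space let $\sigma=(\sigma(t))_{t\ge 0}$ and $\tau=(\tau(t))_{t\ge0}$ be independent (driftless) subordinators started at $0$, $\sigma$ with Lévy measure $x^{-(1+\alpha)}e^{-x}\,dx$ on $(0,\infty)$ and $\tau$ (the gamma subordinator) with Lévy measure $x^{-1}e^{-x}\,dx$ on $(0,\infty)$. Let $\nu$ be a probability measure on $[0,1]$ without atoms and with support $[0,1]$, let $n\ge 1$ and $0=t_0<t_1<\cdots<t_n=1$, put $A_1=[0,t_1]$, $A_i=(t_{i-1},t_i]$ for $2\le i\le n$, and $a_i=\nu(A_i)$. For $\theta>0$ set $$\gamma(\alpha,\theta)=\frac{\alpha\,\tau(\theta/\alpha)}{\Gamma(1-\alpha)},\qquad Y_{\alpha,\theta}(t)=\sigma(\gamma(\alpha,\theta)\,t),$$ $$\mathbf Z_{\alpha,\theta}(t_1,\dots,t_n)=\frac1\theta\Big(Y_{\alpha,\theta}(a_1),\,Y_{\alpha,\theta}(a_1+a_2)-Y_{\alpha,\theta}(a_1),\,\dots,\,Y_{\alpha,\theta}\big(\textstyle\sum_{j=1}^{n}a_j\big)-Y_{\alpha,\theta}\big(\sum_{j=1}^{n-1}a_j\big)\Big).$$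 Let $$\psi(\lambda)=\begin{cases}\frac{\Gamma(1-\alpha)}{\alpha}\,[1-(1-\lambda)^{\alpha}],&\lambda\le 1,\\ \infty,&\lambda>1,\end{cases}\qquad L(\lambda)=\begin{cases}\log\frac1{1-\lambda},&\lambda<1,\\ \infty,&\lambda\ge 1,\end{cases}\qquad L(\infty)=\infty,$$ $$\Lambda(\lambda_1,\dots,\lambda_n)=\frac1\alpha L\Big(\frac{\alpha}{\Gamma(1-\alpha)}\sum_{i=1}^n\nu(A_i)\psi(\lambda_i)\Big)\quad\text{for }(\lambda_1,\dots,\lambda_n)\in\mathbb R^n .$$ Then $\psi(\lambda)=\log E[e^{\lambda\sigma(1)}]$ and $L(\lambda)=\lim_{\theta\to\infty}\frac1\theta\log E[e^{\lambda\tau(\theta)}]$ for every $\lambda\in\mathbb R$, and, as $\theta\to\infty$, the family of the laws of $\mathbf Z_{\alpha,\theta}(t_1,\dots,t_n)$ on $\mathbb R_+^n=[0,\infty)^n$ satisfies a large deviation principle with speed $\theta$ and good rate function $$J_{t_1,\dots,t_n}(y_1,\dots,y_n)=\sup_{\lambda\in\mathbb R^n}\Big\{\sum_{i=1}^n\lambda_iy_i-\Lambda(\lambda_1,\dots,\lambda_n)\Big\}=\sup_{\lambda\in(-\infty,1]^n}\Big\{\sum_{i=1}^n\lambda_iy_i+\frac1\alpha\log\Big[\sum_{i=1}^n\nu(A_i)(1-\lambda_i)^\alpha\Big]\Big\},$$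 where $\log 0=-\infty$. That is, $J_{t_1,\dots,t_n}:\mathbb R_+^n\to[0,\infty]$ is lower semicontinuous with compact sublevel sets, and for every closed $F\subseteq\mathbb R_+^n$ and every open $G\subseteq\mathbb R_+^n$, $$\limsup_{\theta\to\infty}\frac1\theta\log P(\mathbf Z_{\alpha,\theta}\in F)\le-\inf_{F}J_{t_1,\dots,t_n},\qquad \liminf_{\theta\to\infty}\frac1\theta\log P(\mathbf Z_{\alpha,\theta}\in G)\ge-\inf_{G}J_{t_1,\dots,t_n}.$$ -/

import Mathlib

open MeasureTheory ProbabilityTheory Filter Topology Set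
open scoped NNReal ENNReal

noncomputable section

namespace TwoParamDirichlet

/-! ### Large deviation principles -/

/-- The family `(μ θ)` satisfies, as `θ → ∞`, a large deviation principle with speed `θ` and good
rate function `J` (a lower semicontinuous function with values in `[0, ∞]` and compact sublevel
sets). Here `ENNReal.log 0 = ⊥ = -∞`, and an infimum over the empty set is `⊤ = ∞`. -/
structure SatisfiesLDP {X : Type*} [TopologicalSpace X] [MeasurableSpace X]
    (μ : ℝ → Measure X) (J : X → EReal) : Prop where
  nonneg : ∀ x, 0 ≤ J x
  lowerSemicontinuous : LowerSemicontinuous J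
  isCompact_sublevel : ∀ c : ℝ, IsCompact {x | J x ≤ (c : EReal)}
  upper_bound : ∀ F : Set X, IsClosed F →
    limsup (fun θ : ℝ => ((1 / θ : ℝ) : EReal) * ENNReal.log (μ θ F)) atTop ≤ -(⨅ x ∈ F, J x)
  lower_bound : ∀ G : Set X, IsOpen G →
    -(⨅ x ∈ G, J x) ≤ liminf (fun θ : ℝ => ((1 / θ : ℝ) : EReal) * ENNReal.log (μ θ G)) atTop

/-! ### Subordinators -/

/-- `Π` is the Lévy measure of a subordinator: it lives on `(0, ∞)` and `∫ min(1, x) Π(dx) < ∞`. -/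
structure IsSubordinatorLevyMeasure (Pi : Measure ℝ) : Prop where
  nonpos_null : Pi (Iic 0) = 0
  lintegral_min_lt_top : ∫⁻ x, ENNReal.ofReal (min 1 x) ∂Pi < ⊤

/-- `X` is a (driftless, unkilled) subordinator with Lévy measure `Π`: it starts at `0`, has
nondecreasing right-continuous paths and independent stationary increments, and its Laplace
exponent is `∫ (1 - e^{-s x}) Π(dx)`. -/
structure IsSubordinator {Ω : Type*} [MeasurableSpace Ω] (P : Measure Ω)
    (X : ℝ≥0 → Ω → ℝ≥0) (Pi : Measure ℝ) : Prop where
  levyMeasure : IsSubordinatorLevyMeasure Pi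
  measurable : ∀ t, Measurable (X t)
  start : ∀ᵐ ω ∂P, X 0 ω = 0
  monotone_paths : ∀ᵐ ω ∂P, Monotone (fun t => X t ω)
  rightContinuous_paths : ∀ᵐ ω ∂P, ∀ t, ContinuousWithinAt (fun s => X s ω) (Ici t) t
  indep_increments : HasIndepIncrements (fun t ω => (X t ω : ℝ)) P
  stationary_increments : ∀ s t : ℝ≥0,
    IdentDistrib (fun ω => (X (s + t) ω : ℝ) - (X s ω : ℝ)) (fun ω => (X t ω : ℝ)) P P
  laplace : ∀ (t : ℝ≥0) (s : ℝ), 0 ≤ s →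
    ∫ ω, Real.exp (-(s * (X t ω : ℝ))) ∂P =
      Real.exp (-((t : ℝ) * ∫ x, (1 - Real.exp (-(s * x))) ∂Pi))

/-- The measure `x^{-(1+α)} e^{-x} dx` on `(0, ∞)`. -/
def temperedStableLevy (α : ℝ) : Measure ℝ :=
  (volume.restrict (Ioi 0)).withDensity
    (fun x => ENNReal.ofReal (x ^ (-(1 + α)) * Real.exp (-x)))

/-- The measure `x^{-1} e^{-x} dx` on `(0, ∞)`. -/
def gammaLevy : Measure ℝ :=
  (volume.restrict (Ioi 0)).withDensity (fun x => ENNReal.ofReal (x⁻¹ * Real.exp (-x)))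

/-! ### The time-changed process and its rescaled increments -/

section TimeChange

variable {Ω : Type*}

/-- `γ(α, θ) = α τ(θ/α) / Γ(1-α)`. -/
def gammaTime (α : ℝ) (τ : ℝ≥0 → Ω → ℝ≥0) (θ : ℝ) (ω : Ω) : ℝ :=
  α * (τ (Real.toNNReal (θ / α)) ω : ℝ) / Real.Gamma (1 - α)

/-- `Y_{α,θ}(t) = σ(γ(α, θ) t)`. -/
def timeChanged (α : ℝ) (σ τ : ℝ≥0 → Ω → ℝ≥0) (θ t : ℝ) (ω : Ω) : ℝ :=
  (σ (Real.toNNReal (gammaTime α τ θ ω * t)) ω : ℝ)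

/-- The cell `A_i` of the partition `0 = t_0 < t_1 < ⋯ < t_n = 1` of `[0,1]`; the first cell is
`[0, t_1]`, the others are `(t_{i-1}, t_i]`. The index `i : Fin n` stands for `i + 1`. -/
def cell {n : ℕ} (t : Fin (n + 1) → unitInterval) (i : Fin n) : Set unitInterval :=
  if (i : ℕ) = 0 then Icc (t i.castSucc) (t i.succ) else Ioc (t i.castSucc) (t i.succ)

/-- `a_i = ν(A_i)`. -/
def cellMass {n : ℕ} (ν : Measure unitInterval) (t : Fin (n + 1) → unitInterval) (i : Fin n) : ℝ :=
  ν.real (cell t i)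

/-- The partial sum `a_1 + ⋯ + a_k`. -/
def partialMass {n : ℕ} (a : Fin n → ℝ) (k : Fin (n + 1)) : ℝ :=
  ∑ j : Fin n with j.castSucc < k, a j

/-- The rescaled increments
`Z_i = (Y(a_1 + ⋯ + a_i) - Y(a_1 + ⋯ + a_{i-1})) / θ`, as a point of `R_+^n`. (The subtraction and
division are real; the value is nonnegative almost surely since `σ` is nondecreasing, and
`Y(0) = σ(0) = 0`.) -/
def rescaledIncrements {n : ℕ} (α : ℝ) (a : Fin n → ℝ) (σ τ : ℝ≥0 → Ω → ℝ≥0) (θ : ℝ) (ω : Ω) :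
    Fin n → ℝ≥0 :=
  fun i => Real.toNNReal
    ((timeChanged α σ τ θ (partialMass a i.succ) ω
      - timeChanged α σ τ θ (partialMass a i.castSucc) ω) / θ)

end TimeChange

/-! ### The rate function -/

/-- `ψ(l) = Γ(1-α)/α · (1 - (1-l)^α)` for `l ≤ 1`, and `∞` otherwise. -/
def psi (α l : ℝ) : EReal :=
  if l ≤ 1 then ((Real.Gamma (1 - α) / α * (1 - (1 - l) ^ α) : ℝ) : EReal) else ⊤

/-- `L(s) = log(1/(1-s))` for `s < 1`, and `∞` otherwise (also `L(∞) = ∞`). It is only applied to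
`s > -∞`. -/
def gammaCumulant (s : EReal) : EReal :=
  if s < 1 then ((Real.log (1 / (1 - s.toReal)) : ℝ) : EReal) else ⊤

/-- `Λ(l) = (1/α) L((α/Γ(1-α)) ∑ a_i ψ(l_i))`. -/
def Lam {n : ℕ} (α : ℝ) (a : Fin n → ℝ) (l : Fin n → ℝ) : EReal :=
  ((1 / α : ℝ) : EReal) *
    gammaCumulant (((α / Real.Gamma (1 - α) : ℝ) : EReal) * ∑ i, (a i : EReal) * psi α (l i))

/-- `J(y) = sup_l {∑ l_i y_i - Λ(l)}`, the Legendre transform of `Λ`. -/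
def rateJ {n : ℕ} (α : ℝ) (a : Fin n → ℝ) (y : Fin n → ℝ≥0) : EReal :=
  ⨆ l : Fin n → ℝ, ((∑ i, l i * (y i : ℝ) : ℝ) : EReal) - Lam α a l

end TwoParamDirichlet

end

namespace TwoParamDirichlet

/-! ### Extending Laplace transforms to exponential moments -/

section LaplaceExtension

variable {Ω : Type*} [MeasurableSpace Ω] {P : Measure Ω} [IsProbabilityMeasure P] {X : Ω → ℝ}

/-! The exponential moments are explicit for every `θ > 0`, not only asymptotically. Given the clock
`γ(α, θ)`, the increments of `σ` are independent with cumulants `γ a_i ψ(l_i)`; since `∑ a_i = 1`,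
these add up to `(1 - S) τ(θ/α)` with `S = ∑ a_i (1 - l_i)^α`. Averaging over `τ` gives `E exp(θ ∑
l_i Z_i) = S^(-θ/α) = exp(θ Λ(l))` wherever all `l_i ≤ 1` and `S > 0`
(`lintegral_exp_rescaledIncrements`).

The large deviation principle then follows in the manner of Gärtner and Ellis
(`satisfiesLDP_legendre`): Chernoff bounds on finitely many half-spaces for closed sets, exponential
tilting for open sets. Tilting reaches every `y` with positive coordinates, because such a `y` is a
gradient of `Λ` at an interior point (`exists_gradient_eq`); if some `y_i = 0`, the rate is infinite
(`legendre_eq_top_of_eq_zero`) and nothing is required.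

The subordinators are given by Laplace transforms at `s ≥ 0` only, so moments at positive exponents
come from analytic continuation (`lintegral_exp_eq_of_laplace`). -/

theorem integrable_exp_mul_of_nonpos (hX : Measurable X) (h0 : ∀ ω, 0 ≤ X ω) {l : ℝ} (hl : l ≤ 0) :
    Integrable (fun ω => Real.exp (l * X ω)) P := by
  refine Integrable.of_bound (by fun_prop) 1 (Eventually.of_forall fun ω => ?_)
  rw [Real.norm_eq_abs, Real.abs_exp, Real.exp_le_one_iff]
  exact mul_nonpos_of_nonpos_of_nonneg hl (h0 ω)

theorem Iio_subset_interior_integrableExpSet (hX : Measurable X) (h0 : ∀ ω, 0 ≤ X ω) :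
    Iio 0 ⊆ interior (integrableExpSet X P) :=
  interior_maximal (fun _ hl => integrable_exp_mul_of_nonpos hX h0 (le_of_lt hl)) isOpen_Iio

/-- Identity theorem: both sides are analytic on a connected half plane and agree at real points
accumulating at `-1`. -/
theorem complexMGF_eqOn_of_mgf (hX : Measurable X) (h0 : ∀ ω, 0 ≤ X ω) {G : ℂ → ℂ}
    (hG : DifferentiableOn ℂ G {z | z.re < 1})
    (hlap : ∀ s : ℝ, s ≤ 0 → ((mgf X P s : ℝ) : ℂ) = G s) :
    EqOn (complexMGF X P) G {z | z.re < 0} := by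
  have hopen : IsOpen {z : ℂ | z.re < 0} := isOpen_Iio.preimage Complex.continuous_re
  have h1 : AnalyticOnNhd ℂ (complexMGF X P) {z | z.re < 0} :=
    analyticOnNhd_complexMGF.mono fun z hz => Iio_subset_interior_integrableExpSet hX h0 hz
  have h2 : AnalyticOnNhd ℂ G {z | z.re < 0} :=
    (hG.mono fun z (hz : z.re < 0) => lt_trans hz one_pos).analyticOnNhd hopen
  refine h1.eqOn_of_preconnected_of_frequently_eq h2
    (((convex_Iio (0 : ℝ)).linear_preimage Complex.reLm).isPreconnected)
    (z₀ := ((-1 : ℝ) : ℂ)) (by simp) ?_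
  have hev : ∀ᶠ x : ℝ in 𝓝[≠] (-1), complexMGF X P x = G x := by
    filter_upwards [mem_nhdsWithin_of_mem_nhds (Iio_mem_nhds (by norm_num : (-1 : ℝ) < 0))] with x hx
    rw [complexMGF_ofReal, hlap x (le_of_lt hx)]
  have htend : Tendsto (fun x : ℝ => (x : ℂ)) (𝓝[≠] (-1)) (𝓝[≠] ((-1 : ℝ) : ℂ)) := by
    refine tendsto_nhdsWithin_iff.2 ⟨?_, ?_⟩
    · exact (Complex.continuous_ofReal.tendsto _).mono_left nhdsWithin_le_nhds
    · filter_upwards [self_mem_nhdsWithin] with x hx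
      intro h
      exact hx (by exact_mod_cast Set.mem_singleton_iff.1 h)
  exact htend.frequently hev.frequently

/-- If the Laplace transform of a nonnegative random variable extends holomorphically to the half
plane `re z < 1`, then the exponential moments below `1` are finite and given by the extension. -/
theorem lintegral_exp_eq_of_laplace (hX : Measurable X) (h0 : ∀ ω, 0 ≤ X ω) {G : ℂ → ℂ}
    (hG : DifferentiableOn ℂ G {z | z.re < 1})
    (hlap : ∀ s : ℝ, s ≤ 0 → ((mgf X P s : ℝ) : ℂ) = G s) {l : ℝ} (hl : l < 1) :
    ∫⁻ ω, ENNReal.ofReal (Real.exp (l * X ω)) ∂P = ENNReal.ofReal (G l).re := by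
  rcases le_or_gt l 0 with hl0 | hl0
  · rw [← ofReal_integral_eq_lintegral_ofReal (integrable_exp_mul_of_nonpos hX h0 hl0)
      (Eventually.of_forall fun _ => (Real.exp_pos _).le), ← hlap l hl0]
    simp [mgf]
  have hint : (-1 : ℂ).re ∈ interior (integrableExpSet X P) :=
    Iio_subset_interior_integrableExpSet hX h0 (by simp)
  -- The Taylor coefficients of `G` at `-1` are, up to `k!`, the nonnegative moments `E[X^k
  -- e^{-X}]`.
  have hderiv (k : ℕ) : iteratedDeriv k G (-1) =
      ((∫ ω, X ω ^ k * Real.exp (-X ω) ∂P : ℝ) : ℂ) := by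
    have hEq : complexMGF X P =ᶠ[𝓝 (-1)] G :=
      (complexMGF_eqOn_of_mgf hX h0 hG hlap).eventuallyEq_of_mem
        ((isOpen_Iio.preimage Complex.continuous_re).mem_nhds (by simp))
    rw [← hEq.iteratedDeriv_eq k, iteratedDeriv_complexMGF hint, ← integral_complex_ofReal]
    simp
  -- Radius `2` is the largest that stays in the half plane; the disc contains all of `(0, 1)`.
  have hball : Metric.ball (-1 : ℂ) 2 ⊆ {z | z.re < 1} := fun z hz => by
    have h1 : (z - (-1)).re ≤ ‖z - (-1)‖ := Complex.re_le_norm _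
    rw [Metric.mem_ball, dist_eq_norm] at hz
    simp only [sub_neg_eq_add, Complex.add_re, Complex.one_re] at h1 hz
    change z.re < 1
    linarith
  have hmem : (l : ℂ) ∈ Metric.ball (-1 : ℂ) 2 := by
    rw [Metric.mem_ball, dist_eq_norm, sub_neg_eq_add, ← Complex.ofReal_one, ← Complex.ofReal_add,
      Complex.norm_real, Real.norm_eq_abs, abs_of_pos (by linarith)]
    linarith
  have hsum := Complex.hasSum_re (Complex.hasSum_taylorSeries_on_ball (hG.mono hball) hmem)
  have hterm (k : ℕ) : (((Nat.factorial k : ℂ))⁻¹ • ((l : ℂ) - -1) ^ k • iteratedDeriv k G (-1)).re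
      = (Nat.factorial k : ℝ)⁻¹ * ((l + 1) ^ k * ∫ ω, X ω ^ k * Real.exp (-X ω) ∂P) := by
    rw [hderiv, ← Complex.ofReal_re ((Nat.factorial k : ℝ)⁻¹ * _)]
    congr 1
    push_cast
    simp
  simp_rw [hterm] at hsum
  have hpoint (ω : Ω) : ENNReal.ofReal (Real.exp (l * X ω)) = ∑' k : ℕ, ENNReal.ofReal
      ((Nat.factorial k : ℝ)⁻¹ * (l + 1) ^ k * (X ω ^ k * Real.exp (-X ω))) := by
    have hs : HasSum (fun k : ℕ => ((l + 1) * X ω) ^ k / (Nat.factorial k : ℝ))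
        (Real.exp ((l + 1) * X ω)) := by
      rw [Real.exp_eq_exp_ℝ]; exact NormedSpace.expSeries_div_hasSum_exp _
    have hs' := hs.mul_right (Real.exp (-X ω))
    rw [← Real.exp_add] at hs'
    rw [show l * X ω = (l + 1) * X ω + -X ω by ring, ← hs'.tsum_eq,
      ENNReal.ofReal_tsum_of_nonneg _ hs'.summable]
    · refine tsum_congr fun k => ?_
      congr 1
      rw [mul_pow]; ring
    · intro k
      have := h0 ω
      positivity
  have hI (k : ℕ) : Integrable (fun ω => X ω ^ k * Real.exp (-X ω)) P := by
    simpa using integrable_pow_mul_exp_of_mem_interior_integrableExpSet hint k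
  simp_rw [hpoint]
  -- All terms are nonnegative, so sum and integral commute with no prior integrability of `e^{lX}`.
  rw [lintegral_tsum (fun k => by fun_prop), ← hsum.tsum_eq,
    ENNReal.ofReal_tsum_of_nonneg _ hsum.summable]
  · refine tsum_congr fun k => ?_
    rw [← mul_assoc, ← integral_const_mul, ofReal_integral_eq_lintegral_ofReal
      ((hI k).const_mul _)]
    refine Eventually.of_forall fun ω => ?_
    have := h0 ω
    have : 0 ≤ l + 1 := by linarith
    positivity
  · intro k
    have : 0 ≤ ∫ ω, X ω ^ k * Real.exp (-X ω) ∂P :=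
      integral_nonneg fun ω => by have := h0 ω; positivity
    have : 0 ≤ l + 1 := by linarith
    positivity

end LaplaceExtension

/-! ### The Laplace exponents -/

/-- Write `1 - e^{-sx} = x ∫_0^s e^{-ux} du` and apply Tonelli; the integral in `x` is then a Gamma
integral. Taking `β = α` serves `σ`, and `β = 0` serves `τ`. -/
theorem integral_one_sub_exp_mul_rpow {β s : ℝ} (hβ : β < 1) (hs : 0 ≤ s) :
    ∫ x in Ioi (0 : ℝ), x ^ (-(1 + β)) * Real.exp (-x) * (1 - Real.exp (-(s * x))) =
      Real.Gamma (1 - β) * ∫ u in (0 : ℝ)..s, (1 + u) ^ (β - 1) := by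
  have hΓ : 0 < Real.Gamma (1 - β) := Real.Gamma_pos_of_pos (by linarith)
  have hinner (x : ℝ) (hx : 0 < x) :
      ENNReal.ofReal (x ^ (-(1 + β)) * Real.exp (-x) * (1 - Real.exp (-(s * x)))) =
      ∫⁻ u in Ioc (0 : ℝ) s, ENNReal.ofReal (x ^ (1 - β - 1) * Real.exp (-((1 + u) * x))) := by
    have hcont : Continuous fun u : ℝ => x ^ (1 - β - 1) * Real.exp (-((1 + u) * x)) := by fun_prop
    rw [← ofReal_integral_eq_lintegral_ofReal
      (hcont.integrableOn_Icc.mono_set Ioc_subset_Icc_self)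
      (Eventually.of_forall fun u => by positivity),
      ← intervalIntegral.integral_of_le hs]
    congr 1
    have hd (u : ℝ) (_ : u ∈ uIcc 0 s) : HasDerivAt
        (fun u => -(x ^ (-(1 + β)) * Real.exp (-((1 + u) * x))))
        (x ^ (1 - β - 1) * Real.exp (-((1 + u) * x))) u := by
      have h1 : HasDerivAt (fun u : ℝ => -((1 + u) * x)) (-(1 * x)) u :=
        (((hasDerivAt_id u).const_add 1).mul_const x).neg
      refine ((h1.exp).const_mul (x ^ (-(1 + β)))).neg.congr_deriv ?_
      rw [show 1 - β - 1 = -(1 + β) + 1 by ring, Real.rpow_add_one hx.ne']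
      ring
    rw [intervalIntegral.integral_eq_sub_of_hasDerivAt hd (hcont.intervalIntegrable _ _)]
    rw [show -((1 + s) * x) = -x + -(s * x) by ring, Real.exp_add]
    simp
    ring
  have houter (u : ℝ) (hu : 0 < u) :
      ∫⁻ x in Ioi (0 : ℝ), ENNReal.ofReal (x ^ (1 - β - 1) * Real.exp (-((1 + u) * x))) =
        ENNReal.ofReal (Real.Gamma (1 - β) * (1 + u) ^ (β - 1)) := by
    have h1 := Real.integral_rpow_mul_exp_neg_mul_Ioi (a := 1 - β) (r := 1 + u) (by linarith)
      (by linarith)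
    -- A non-integrable function has Bochner integral `0`, so a nonzero value proves integrability.
    have hne : (1 / (1 + u)) ^ (1 - β) * Real.Gamma (1 - β) ≠ 0 := by positivity
    rw [← ofReal_integral_eq_lintegral_ofReal (Integrable.of_integral_ne_zero (h1 ▸ hne)), h1,
      one_div, Real.inv_rpow (by linarith), ← Real.rpow_neg (by linarith), mul_comm, neg_sub]
    filter_upwards [ae_restrict_mem measurableSet_Ioi] with x hx
    have : (0 : ℝ) < x := hx
    change 0 ≤ _
    positivity
  have hcont : ContinuousOn (fun u : ℝ => Real.Gamma (1 - β) * (1 + u) ^ (β - 1)) (Icc 0 s) := by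
    refine continuousOn_const.mul (ContinuousOn.rpow_const (by fun_prop) fun u hu => Or.inl ?_)
    have := hu.1
    positivity
  have hnn : ∀ x ∈ Ioi (0 : ℝ),
      0 ≤ x ^ (-(1 + β)) * Real.exp (-x) * (1 - Real.exp (-(s * x))) := fun x hx => by
    have hx' : (0 : ℝ) < x := hx
    have : Real.exp (-(s * x)) ≤ 1 := Real.exp_le_one_iff.2 (by nlinarith)
    have : 0 ≤ 1 - Real.exp (-(s * x)) := by linarith
    positivity
  rw [integral_eq_lintegral_of_nonneg_ae
    ((ae_restrict_mem measurableSet_Ioi).mono fun x hx => hnn x hx)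
    (by fun_prop), setLIntegral_congr_fun measurableSet_Ioi hinner,
    lintegral_lintegral_swap (by fun_prop),
    setLIntegral_congr_fun measurableSet_Ioc (fun u hu => houter u hu.1),
    ← ofReal_integral_eq_lintegral_ofReal
      (hcont.integrableOn_Icc.mono_set Ioc_subset_Icc_self),
    ← intervalIntegral.integral_of_le hs, intervalIntegral.integral_const_mul, ENNReal.toReal_ofReal]
  · refine mul_nonneg hΓ.le (intervalIntegral.integral_nonneg hs fun u hu => ?_)
    have := hu.1
    positivity
  · filter_upwards [ae_restrict_mem measurableSet_Ioc] with u hu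
    have := hu.1
    change 0 ≤ _
    positivity

theorem integral_withDensity_ofReal_Ioi {f : ℝ → ℝ} (hf : Measurable f) (hf0 : ∀ x, 0 < x → 0 ≤ f x)
    (g : ℝ → ℝ) :
    ∫ x, g x ∂((volume.restrict (Ioi 0)).withDensity fun x => ENNReal.ofReal (f x)) =
      ∫ x in Ioi 0, f x * g x := by
  rw [integral_withDensity_eq_integral_toReal_smul (by fun_prop)
    (Eventually.of_forall fun _ => ENNReal.ofReal_lt_top)]
  refine setIntegral_congr_fun measurableSet_Ioi fun x hx => ?_
  simp only [smul_eq_mul]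
  rw [ENNReal.toReal_ofReal (hf0 x hx)]

theorem laplaceExponent_temperedStable {α s : ℝ} (hα0 : 0 < α) (hα1 : α < 1) (hs : 0 ≤ s) :
    ∫ x, (1 - Real.exp (-(s * x))) ∂(temperedStableLevy α) =
      Real.Gamma (1 - α) / α * ((1 + s) ^ α - 1) := by
  rw [temperedStableLevy, integral_withDensity_ofReal_Ioi (by fun_prop)
    (fun x hx => by positivity), integral_one_sub_exp_mul_rpow hα1 hs]
  have h : ∫ u in (0 : ℝ)..s, (1 + u) ^ (α - 1) = ((1 + s) ^ α - 1) / α := by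
    rw [intervalIntegral.integral_comp_add_left (fun u => u ^ (α - 1)) 1,
      integral_rpow (Or.inl (by linarith))]
    simp
  rw [h]; ring

theorem laplaceExponent_gamma {s : ℝ} (hs : 0 ≤ s) :
    ∫ x, (1 - Real.exp (-(s * x))) ∂gammaLevy = Real.log (1 + s) := by
  rw [gammaLevy, integral_withDensity_ofReal_Ioi (by fun_prop) (fun x hx => by positivity)]
  have h0 := integral_one_sub_exp_mul_rpow (β := 0) (by norm_num) hs
  simp only [add_zero, sub_zero, Real.Gamma_one, one_mul, Real.rpow_neg_one, zero_sub] at h0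
  rw [h0, intervalIntegral.integral_comp_add_left (fun u => u⁻¹) 1, add_zero,
    integral_inv_of_pos one_pos (by linarith), div_one]

/-! ### Exponential moments up to and beyond the critical exponent `1` -/

section ExponentialMoments

variable {Ω : Type*} [MeasurableSpace Ω] {P : Measure Ω}

theorem lintegral_exp_mono {X : Ω → ℝ} (h0 : ∀ ω, 0 ≤ X ω) {l m : ℝ} (h : l ≤ m) :
    ∫⁻ ω, ENNReal.ofReal (Real.exp (l * X ω)) ∂P ≤ ∫⁻ ω, ENNReal.ofReal (Real.exp (m * X ω)) ∂P :=
  lintegral_mono fun ω => ENNReal.ofReal_le_ofReal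
    (Real.exp_le_exp.2 (mul_le_mul_of_nonneg_right h (h0 ω)))

theorem tendsto_one_sub_one_div_atTop :
    Tendsto (fun k : ℕ => 1 - 1 / ((k : ℝ) + 1)) atTop (𝓝 1) := by
  simpa using (tendsto_one_div_add_atTop_nhds_zero_nat (𝕜 := ℝ)).const_sub 1

theorem tendsto_lintegral_exp_one {X : Ω → ℝ} (hX : Measurable X) (h0 : ∀ ω, 0 ≤ X ω) :
    Tendsto (fun k : ℕ => ∫⁻ ω, ENNReal.ofReal (Real.exp ((1 - 1 / ((k : ℝ) + 1)) * X ω)) ∂P) atTop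
      (𝓝 (∫⁻ ω, ENNReal.ofReal (Real.exp (1 * X ω)) ∂P)) := by
  refine lintegral_tendsto_of_tendsto_of_monotone (fun k => by fun_prop)
    (Eventually.of_forall fun ω => ?_) (Eventually.of_forall fun ω => ?_)
  · intro j k hjk
    refine ENNReal.ofReal_le_ofReal (Real.exp_le_exp.2 (mul_le_mul_of_nonneg_right ?_ (h0 ω)))
    gcongr
  · exact ENNReal.tendsto_ofReal ((Real.continuous_exp.tendsto _).comp
      (tendsto_one_sub_one_div_atTop.mul_const _))

theorem one_sub_mem_slitPlane {z : ℂ} (hz : z.re < 1) : 1 - z ∈ Complex.slitPlane := by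
  left
  simpa using hz

variable [IsProbabilityMeasure P]

/-- Analytic continuation covers `l < 1`; the endpoint `l = 1` follows by monotone convergence,
since `(1 - l)^α` is continuous there. -/
theorem lintegral_exp_of_laplace_temperedStable {X : Ω → ℝ} (hX : Measurable X)
    (h0 : ∀ ω, 0 ≤ X ω) {α : ℝ} (hα0 : 0 < α) {c : ℝ}
    (hlap : ∀ s : ℝ, 0 ≤ s → ∫ ω, Real.exp (-(s * X ω)) ∂P = Real.exp (c * (1 - (1 + s) ^ α)))
    {l : ℝ} (hl : l ≤ 1) :
    ∫⁻ ω, ENNReal.ofReal (Real.exp (l * X ω)) ∂P =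
      ENNReal.ofReal (Real.exp (c * (1 - (1 - l) ^ α))) := by
  have key (m : ℝ) (hm : m < 1) : ∫⁻ ω, ENNReal.ofReal (Real.exp (m * X ω)) ∂P =
      ENNReal.ofReal (Real.exp (c * (1 - (1 - m) ^ α))) := by
    have hcast (s : ℝ) (hs : s ≤ 1) : ((Real.exp (c * (1 - (1 - s) ^ α)) : ℝ) : ℂ) =
        Complex.exp (c * (1 - (1 - (s : ℂ)) ^ (α : ℂ))) := by
      push_cast [Complex.ofReal_cpow (show 0 ≤ 1 - s by linarith)]
      rfl
    rw [lintegral_exp_eq_of_laplace hX h0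
      (G := fun z => Complex.exp (c * (1 - (1 - z) ^ (α : ℂ)))) ?_ ?_ hm, ← hcast m hm.le,
      Complex.ofReal_re]
    · intro z hz
      refine DifferentiableAt.differentiableWithinAt ?_
      have : DifferentiableAt ℂ (fun z : ℂ => (1 - z) ^ (α : ℂ)) z :=
        (((differentiableAt_const _).sub differentiableAt_id)).cpow_const (one_sub_mem_slitPlane hz)
      fun_prop
    · intro s hs
      rw [← hcast s (by linarith)]
      have := hlap (-s) (by linarith)
      simp only [neg_mul, neg_neg] at this
      rw [mgf, this, sub_eq_add_neg 1 s]
  rcases hl.lt_or_eq with hl | rfl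
  · exact key l hl
  refine tendsto_nhds_unique (tendsto_lintegral_exp_one hX h0) ?_
  simp_rw [key _ (show 1 - 1 / ((_ : ℕ) + 1 : ℝ) < 1 by simp; positivity)]
  have hc : Continuous fun m : ℝ => ENNReal.ofReal (Real.exp (c * (1 - (1 - m) ^ α))) := by
    have : Continuous fun m : ℝ => (1 - m) ^ α :=
      (continuous_const.sub continuous_id).rpow_const fun _ => Or.inr hα0.le
    exact ENNReal.continuous_ofReal.comp (by fun_prop)
  exact (hc.tendsto 1).comp tendsto_one_sub_one_div_atTop

/-- A finite moment beyond `1` would make the moment generating function differentiable at `1`,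
whereas `(1 - l)^α` has infinite slope there because `α < 1`. -/
theorem lintegral_exp_eq_top_of_laplace_temperedStable {X : Ω → ℝ} (hX : Measurable X)
    (h0 : ∀ ω, 0 ≤ X ω) {α : ℝ} (hα0 : 0 < α) (hα1 : α < 1) {c : ℝ} (hc : 0 < c)
    (hlap : ∀ s : ℝ, 0 ≤ s → ∫ ω, Real.exp (-(s * X ω)) ∂P = Real.exp (c * (1 - (1 + s) ^ α)))
    {l : ℝ} (hl : 1 < l) :
    ∫⁻ ω, ENNReal.ofReal (Real.exp (l * X ω)) ∂P = ⊤ := by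
  by_contra hne
  have hsub : Iio l ⊆ integrableExpSet X P := fun m hm => by
    refine ⟨by fun_prop, ?_⟩
    rw [hasFiniteIntegral_iff_ofReal (Eventually.of_forall fun _ => (Real.exp_pos _).le)]
    exact (lintegral_exp_mono h0 (le_of_lt hm)).trans_lt (lt_top_iff_ne_top.2 hne)
  have hd : DifferentiableAt ℝ (mgf X P) (1 - 0) := by
    rw [sub_zero]
    exact differentiableAt_mgf (interior_maximal hsub isOpen_Iio hl)
  have hval (u : ℝ) (hu : 0 ≤ u) : mgf X P (1 - u) = Real.exp (c * (1 - u ^ α)) := by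
    have h1 := lintegral_exp_of_laplace_temperedStable hX h0 hα0 hlap (l := 1 - u) (by linarith)
    rw [sub_sub_cancel] at h1
    rw [mgf, integral_eq_lintegral_of_nonneg_ae
      (Eventually.of_forall fun _ => (Real.exp_pos _).le) (by fun_prop), h1,
      ENNReal.toReal_ofReal (Real.exp_pos _).le]
  have hd' : DifferentiableAt ℝ (fun u => 1 - Real.log (mgf X P (1 - u)) / c) 0 := by
    have h1 : DifferentiableAt ℝ (fun u => mgf X P (1 - u)) 0 :=
      DifferentiableAt.comp (g := mgf X P) (f := fun u : ℝ => 1 - u) (0 : ℝ) hd (by fun_prop)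
    have h2 : mgf X P (1 - 0) ≠ 0 := by rw [hval 0 le_rfl]; positivity
    exact ((h1.log h2).div_const c).const_sub 1
  have hpow (u : ℝ) (hu : 0 ≤ u) : 1 - Real.log (mgf X P (1 - u)) / c = u ^ α := by
    rw [hval u hu, Real.log_exp]; field_simp; ring
  -- Differentiability at `0` forces `u^α ≤ C u` for small `u > 0`, while `u^(α-1)` is unbounded.
  obtain ⟨C, hC⟩ := hd'.hasDerivAt.isBigO_sub.bound
  have hbound : ∀ᶠ u : ℝ in 𝓝[>] 0, u ^ (α - 1) ≤ C := by
    filter_upwards [hC.filter_mono nhdsWithin_le_nhds, self_mem_nhdsWithin] with u hu (hu0 : 0 < u)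
    rw [hpow u hu0.le, hpow 0 le_rfl, Real.zero_rpow hα0.ne', sub_zero, sub_zero, Real.norm_eq_abs,
      Real.norm_eq_abs, abs_of_nonneg (by positivity), abs_of_pos hu0] at hu
    rw [Real.rpow_sub_one hu0.ne']
    exact (div_le_iff₀ hu0).2 hu
  obtain ⟨u, hu1, hu2⟩ := (hbound.and
    ((tendsto_rpow_neg_nhdsGT_zero (y := α - 1) (by linarith)).eventually_gt_atTop C)).exists
  linarith

theorem lintegral_exp_of_laplace_gamma {X : Ω → ℝ} (hX : Measurable X) (h0 : ∀ ω, 0 ≤ X ω) {c : ℝ}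
    (hlap : ∀ s : ℝ, 0 ≤ s → ∫ ω, Real.exp (-(s * X ω)) ∂P = Real.exp (-(c * Real.log (1 + s))))
    {l : ℝ} (hl : l < 1) :
    ∫⁻ ω, ENNReal.ofReal (Real.exp (l * X ω)) ∂P =
      ENNReal.ofReal (Real.exp (-(c * Real.log (1 - l)))) := by
  have hcast (s : ℝ) (hs : s ≤ 1) : ((Real.exp (-(c * Real.log (1 - s))) : ℝ) : ℂ) =
      Complex.exp (-(c * Complex.log (1 - (s : ℂ)))) := by
    push_cast [Complex.ofReal_log (show 0 ≤ 1 - s by linarith)]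
    rfl
  rw [lintegral_exp_eq_of_laplace hX h0
    (G := fun z => Complex.exp (-(c * Complex.log (1 - z)))) ?_ ?_ hl, ← hcast l hl.le,
    Complex.ofReal_re]
  · intro z hz
    refine DifferentiableAt.differentiableWithinAt ?_
    have : DifferentiableAt ℂ (fun z : ℂ => Complex.log (1 - z)) z :=
      ((differentiableAt_const _).sub differentiableAt_id).clog (one_sub_mem_slitPlane hz)
    fun_prop
  · intro s hs
    rw [← hcast s (by linarith)]
    have := hlap (-s) (by linarith)
    simp only [neg_mul, neg_neg] at this
    rw [mgf, this, sub_eq_add_neg 1 s]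

/-- Unlike the tempered stable case, the moment already blows up as `l` increases to `1`, so
monotone convergence gives `⊤` at the endpoint. -/
theorem lintegral_exp_eq_top_of_laplace_gamma {X : Ω → ℝ} (hX : Measurable X) (h0 : ∀ ω, 0 ≤ X ω)
    {c : ℝ} (hc : 0 < c)
    (hlap : ∀ s : ℝ, 0 ≤ s → ∫ ω, Real.exp (-(s * X ω)) ∂P = Real.exp (-(c * Real.log (1 + s))))
    {l : ℝ} (hl : 1 ≤ l) :
    ∫⁻ ω, ENNReal.ofReal (Real.exp (l * X ω)) ∂P = ⊤ := by
  refine top_le_iff.1 (le_trans (le_of_eq ?_) (lintegral_exp_mono h0 hl))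
  refine tendsto_nhds_unique ?_ (tendsto_lintegral_exp_one hX h0)
  simp_rw [lintegral_exp_of_laplace_gamma hX h0 hlap
    (show 1 - 1 / ((_ : ℕ) + 1 : ℝ) < 1 by simp; positivity)]
  refine ENNReal.tendsto_ofReal_nhds_top.2 (Real.tendsto_exp_atTop.comp ?_)
  have (k : ℕ) : -(c * Real.log (1 - (1 - 1 / ((k : ℝ) + 1)))) = c * Real.log ((k : ℝ) + 1) := by
    rw [sub_sub_cancel, one_div, Real.log_inv]; ring
  simp_rw [this]
  exact (Real.tendsto_log_atTop.comp
    (tendsto_natCast_atTop_atTop.atTop_add tendsto_const_nhds)).const_mul_atTop hc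

end ExponentialMoments

/-! ### Cumulants of the two subordinators -/

section Subordinators

variable {Ω : Type*} [MeasurableSpace Ω] {P : Measure Ω}

theorem IsSubordinator.laplace_temperedStable {α : ℝ} (hα0 : 0 < α) (hα1 : α < 1)
    {σ : ℝ≥0 → Ω → ℝ≥0} (hσ : IsSubordinator P σ (temperedStableLevy α)) (t : ℝ≥0) (s : ℝ)
    (hs : 0 ≤ s) : ∫ ω, Real.exp (-(s * (σ t ω : ℝ))) ∂P =
      Real.exp ((t : ℝ) * (Real.Gamma (1 - α) / α) * (1 - (1 + s) ^ α)) := by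
  rw [hσ.laplace t s hs, laplaceExponent_temperedStable hα0 hα1 hs]
  congr 1; ring

theorem IsSubordinator.laplace_gamma {τ : ℝ≥0 → Ω → ℝ≥0} (hτ : IsSubordinator P τ gammaLevy)
    (t : ℝ≥0) (s : ℝ) (hs : 0 ≤ s) : ∫ ω, Real.exp (-(s * (τ t ω : ℝ))) ∂P =
      Real.exp (-((t : ℝ) * Real.log (1 + s))) := by
  rw [hτ.laplace t s hs, laplaceExponent_gamma hs]

variable [IsProbabilityMeasure P]

theorem IsSubordinator.lintegral_exp_temperedStable {α : ℝ} (hα0 : 0 < α) (hα1 : α < 1)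
    {σ : ℝ≥0 → Ω → ℝ≥0} (hσ : IsSubordinator P σ (temperedStableLevy α)) (t : ℝ≥0) {l : ℝ}
    (hl : l ≤ 1) : ∫⁻ ω, ENNReal.ofReal (Real.exp (l * (σ t ω : ℝ))) ∂P =
      ENNReal.ofReal (Real.exp ((t : ℝ) * (Real.Gamma (1 - α) / α) * (1 - (1 - l) ^ α))) :=
  lintegral_exp_of_laplace_temperedStable (hσ.measurable t).coe_nnreal_real
    (fun _ => NNReal.coe_nonneg _) hα0 (hσ.laplace_temperedStable hα0 hα1 t) hl

theorem IsSubordinator.log_lintegral_exp_one {α : ℝ} (hα0 : 0 < α) (hα1 : α < 1)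
    {σ : ℝ≥0 → Ω → ℝ≥0} (hσ : IsSubordinator P σ (temperedStableLevy α)) (l : ℝ) :
    ENNReal.log (∫⁻ ω, ENNReal.ofReal (Real.exp (l * (σ 1 ω : ℝ))) ∂P) = psi α l := by
  have hΓ : 0 < Real.Gamma (1 - α) := Real.Gamma_pos_of_pos (by linarith)
  by_cases hl : l ≤ 1
  · rw [hσ.lintegral_exp_temperedStable hα0 hα1 1 hl, psi, if_pos hl,
      ENNReal.log_ofReal_of_pos (Real.exp_pos _), Real.log_exp, NNReal.coe_one, one_mul]
  · rw [psi, if_neg hl, lintegral_exp_eq_top_of_laplace_temperedStable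
      (hσ.measurable 1).coe_nnreal_real (fun _ => NNReal.coe_nonneg _) hα0 hα1
      (c := ((1 : ℝ≥0) : ℝ) * (Real.Gamma (1 - α) / α))
      (by rw [NNReal.coe_one]; positivity) (hσ.laplace_temperedStable hα0 hα1 1) (not_le.1 hl),
      ENNReal.log_top]

theorem IsSubordinator.lintegral_exp_gamma {τ : ℝ≥0 → Ω → ℝ≥0} (hτ : IsSubordinator P τ gammaLevy)
    (t : ℝ≥0) {l : ℝ} (hl : l < 1) : ∫⁻ ω, ENNReal.ofReal (Real.exp (l * (τ t ω : ℝ))) ∂P =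
      ENNReal.ofReal (Real.exp (-((t : ℝ) * Real.log (1 - l)))) :=
  lintegral_exp_of_laplace_gamma (hτ.measurable t).coe_nnreal_real
    (fun _ => NNReal.coe_nonneg _) (hτ.laplace_gamma t) hl

/-- The cumulant of `τ(θ)` is exactly linear in `θ`, so the rescaled quantity is constant for `θ >
0`. -/
theorem IsSubordinator.tendsto_cumulant_gamma {τ : ℝ≥0 → Ω → ℝ≥0}
    (hτ : IsSubordinator P τ gammaLevy) (l : ℝ) : Tendsto
      (fun θ : ℝ => ((1 / θ : ℝ) : EReal) *
        ENNReal.log (∫⁻ ω, ENNReal.ofReal (Real.exp (l * (τ (Real.toNNReal θ) ω : ℝ))) ∂P))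
      atTop (𝓝 (gammaCumulant (l : EReal))) := by
  refine tendsto_const_nhds.congr' ?_
  filter_upwards [eventually_gt_atTop 0] with θ hθ
  by_cases hl : l < 1
  · rw [hτ.lintegral_exp_gamma _ hl, ENNReal.log_ofReal_of_pos (Real.exp_pos _), Real.log_exp,
      Real.coe_toNNReal _ hθ.le, gammaCumulant, if_pos (by exact_mod_cast hl), ← EReal.coe_mul,
      EReal.toReal_coe, one_div (1 - l), Real.log_inv]
    congr 1
    field_simp
  · rw [lintegral_exp_eq_top_of_laplace_gamma (hτ.measurable _).coe_nnreal_real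
      (fun _ => NNReal.coe_nonneg _) (c := (Real.toNNReal θ : ℝ)) (by simpa using hθ)
      (hτ.laplace_gamma _) (not_lt.1 hl),
      ENNReal.log_top, gammaCumulant, if_neg (by exact_mod_cast hl),
      EReal.coe_mul_top_of_pos (by positivity)]

end Subordinators

/-! ### Evaluating right-continuous paths at random times -/

/-- The value at `g` of a right-continuous path, recovered from countably many evaluations. -/
noncomputable def rightEval (w : ℝ≥0 → ℝ≥0) (g : ℝ≥0) : ℝ≥0 :=
  (limsup (fun k : ℕ => (w ((⌈g * (k + 1)⌉₊ : ℝ≥0) / (k + 1)) : ℝ≥0∞)) atTop).toNNReal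

/-- Plain evaluation `(w, g) ↦ w g` is not jointly measurable for the product σ-algebra on paths.
Reading `w` only on countably many grid points repairs this, and the `limsup` is defined for every
path. -/
theorem measurable_rightEval : Measurable fun p : (ℝ≥0 → ℝ≥0) × ℝ≥0 => rightEval p.1 p.2 := by
  refine (Measurable.limsup fun k => ?_).ennreal_toNNReal
  have h1 : Measurable fun q : (ℝ≥0 → ℝ≥0) × ℕ => q.1 ((q.2 : ℝ≥0) / (k + 1)) :=
    measurable_from_prod_countable_left fun m =>
      show Measurable fun w : ℝ≥0 → ℝ≥0 => w ((m : ℝ≥0) / (k + 1)) from measurable_pi_apply _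
  have h2 : Measurable fun p : (ℝ≥0 → ℝ≥0) × ℝ≥0 => (p.1, ⌈p.2 * (k + 1)⌉₊) :=
    measurable_fst.prodMk (Nat.measurable_ceil.comp (measurable_snd.mul_const _))
  exact (h1.comp h2).coe_nnreal_ennreal

theorem tendsto_ceil_mul_div (g : ℝ≥0) :
    Tendsto (fun k : ℕ => (⌈g * (k + 1)⌉₊ : ℝ≥0) / (k + 1)) atTop (𝓝[≥] g) := by
  refine tendsto_nhdsWithin_iff.2 ⟨?_, Eventually.of_forall fun k => ?_⟩
  · have hlim : Tendsto (fun k : ℕ => g + 1 / ((k : ℝ≥0) + 1)) atTop (𝓝 g) := by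
      rw [← NNReal.tendsto_coe]
      push_cast
      simpa using (tendsto_one_div_add_atTop_nhds_zero_nat (𝕜 := ℝ)).const_add (g : ℝ)
    refine tendsto_of_tendsto_of_tendsto_of_le_of_le tendsto_const_nhds hlim (fun k => ?_)
      fun k => ?_
    · exact (le_div_iff₀ (by positivity)).2 (Nat.le_ceil _)
    · refine (div_le_iff₀ (by positivity)).2 ((Nat.ceil_lt_add_one (by positivity)).le.trans_eq ?_)
      field_simp
  · rw [mem_Ici, le_div_iff₀ (by positivity)]
    exact Nat.le_ceil _

theorem rightEval_eq {w : ℝ≥0 → ℝ≥0} {g : ℝ≥0} (h : ContinuousWithinAt w (Ici g) g) :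
    rightEval w g = w g := by
  have := (ENNReal.continuous_coe.tendsto (w g)).comp (Tendsto.comp h (tendsto_ceil_mul_div g))
  have h2 := this.limsup_eq
  simp only [Function.comp_def] at h2
  rw [rightEval, h2, ENNReal.toNNReal_coe]

theorem gammaTime_nonneg {Ω : Type*} {τ : ℝ≥0 → Ω → ℝ≥0} {α : ℝ} (hα0 : 0 < α) (hα1 : α < 1) (θ : ℝ)
    (ω : Ω) : 0 ≤ gammaTime α τ θ ω := by
  have hΓ : 0 < Real.Gamma (1 - α) := Real.Gamma_pos_of_pos (by linarith)
  unfold gammaTime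
  positivity

/-! ### Joint exponential moments of the rescaled increments -/

section Increments

variable {Ω : Type*} [MeasurableSpace Ω] {P : Measure Ω} {α : ℝ}
  {σ τ : ℝ≥0 → Ω → ℝ≥0} {n : ℕ}

/-- The rescaled increments as a function of the path of `σ` and of the value of `γ(α, θ)`. -/
noncomputable def incrementMap (p : Fin (n + 1) → ℝ) (θ : ℝ) (q : (ℝ≥0 → ℝ≥0) × ℝ≥0) : Fin n → ℝ≥0 :=
  fun i => Real.toNNReal (((rightEval q.1 (Real.toNNReal (q.2 * p i.succ)) : ℝ) -
    rightEval q.1 (Real.toNNReal (q.2 * p i.castSucc))) / θ)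

theorem measurable_incrementMap (p : Fin (n + 1) → ℝ) (θ : ℝ) :
    Measurable (incrementMap p θ) := by
  refine measurable_pi_lambda _ fun i => ?_
  have h (x : ℝ) : Measurable fun q : (ℝ≥0 → ℝ≥0) × ℝ≥0 =>
      (rightEval q.1 (Real.toNNReal (q.2 * x)) : ℝ) := by
    have h1 : Measurable fun q : (ℝ≥0 → ℝ≥0) × ℝ≥0 => (q.1, Real.toNNReal (q.2 * x)) := by fun_prop
    exact (measurable_rightEval.comp h1).coe_nnreal_real
  exact (((h _).sub (h _)).div_const _).real_toNNReal

theorem rescaledIncrements_ae_eq (hα0 : 0 < α) (hα1 : α < 1) {Pi : Measure ℝ}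
    (hσ : IsSubordinator P σ Pi) (a : Fin n → ℝ) (θ : ℝ) :
    rescaledIncrements α a σ τ θ =ᵐ[P] fun ω =>
      incrementMap (partialMass a) θ (fun t => σ t ω, Real.toNNReal (gammaTime α τ θ ω)) := by
  filter_upwards [hσ.rightContinuous_paths] with ω hω
  funext i
  simp only [rescaledIncrements, incrementMap, timeChanged, rightEval_eq (hω _),
    Real.coe_toNNReal _ (gammaTime_nonneg hα0 hα1 θ ω)]

theorem measurable_path {Pi : Measure ℝ} (hσ : IsSubordinator P σ Pi) :
    Measurable fun ω t => σ t ω :=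
  measurable_pi_lambda _ hσ.measurable

theorem measurable_gammaTime {Pi : Measure ℝ} (hτ : IsSubordinator P τ Pi) (θ : ℝ) :
    Measurable (gammaTime α τ θ) :=
  ((hτ.measurable _).coe_nnreal_real.const_mul _).div_const _

theorem aemeasurable_rescaledIncrements (hα0 : 0 < α) (hα1 : α < 1) {Pi Pi' : Measure ℝ}
    (hσ : IsSubordinator P σ Pi) (hτ : IsSubordinator P τ Pi') (a : Fin n → ℝ) (θ : ℝ) :
    AEMeasurable (rescaledIncrements α a σ τ θ) P := by
  refine (Measurable.aemeasurable ?_).congr (rescaledIncrements_ae_eq hα0 hα1 hσ a θ).symm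
  exact (measurable_incrementMap _ _).comp
    ((measurable_path hσ).prodMk (measurable_gammaTime hτ θ).real_toNNReal)

theorem monotone_partialMass {a : Fin n → ℝ} (ha : ∀ i, 0 ≤ a i) : Monotone (partialMass a) :=
  fun _ _ hjk => Finset.sum_le_sum_of_subset_of_nonneg
    (fun _ hi => by simp only [Finset.mem_filter] at hi ⊢; exact ⟨hi.1, hi.2.trans_le hjk⟩)
    fun i _ _ => ha i

theorem partialMass_zero (a : Fin n → ℝ) : partialMass a 0 = 0 := by
  simp [partialMass]

theorem partialMass_succ (a : Fin n → ℝ) (i : Fin n) :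
    partialMass a i.succ = partialMass a i.castSucc + a i := by
  have : (Finset.univ.filter fun j : Fin n => j.castSucc < i.succ) =
      insert i (Finset.univ.filter fun j : Fin n => j.castSucc < i.castSucc) := by
    ext j
    simp only [Finset.mem_filter, Finset.mem_univ, true_and, Finset.mem_insert, Fin.lt_def,
      Fin.val_succ, Fin.val_castSucc, Fin.ext_iff]
    omega
  rw [partialMass, this, Finset.sum_insert (by simp), partialMass, add_comm]

variable [IsProbabilityMeasure P]

theorem IsSubordinator.lintegral_exp_increments (hα0 : 0 < α) (hα1 : α < 1)
    (hσ : IsSubordinator P σ (temperedStableLevy α)) {p : Fin (n + 1) → ℝ≥0} (hp : Monotone p)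
    {l : Fin n → ℝ} (hl : ∀ i, l i ≤ 1) :
    ∫⁻ ω, ENNReal.ofReal (Real.exp
      (∑ i, l i * ((σ (p i.succ) ω : ℝ) - (σ (p i.castSucc) ω : ℝ)))) ∂P =
    ENNReal.ofReal (Real.exp (∑ i, ((p i.succ : ℝ) - p i.castSucc) *
      (Real.Gamma (1 - α) / α) * (1 - (1 - l i) ^ α))) := by
  have hm (t : ℝ≥0) : Measurable fun ω => (σ t ω : ℝ) := (hσ.measurable t).coe_nnreal_real
  simp_rw [Real.exp_sum, ENNReal.ofReal_prod_of_nonneg (fun _ _ => (Real.exp_pos _).le)]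
  rw [lintegral_prod_eq_prod_lintegral_of_indepFun Finset.univ
    (fun i ω => ENNReal.ofReal (Real.exp (l i * ((σ (p i.succ) ω : ℝ) - (σ (p i.castSucc) ω : ℝ)))))
    ((hσ.indep_increments n p hp).comp (fun i x => ENNReal.ofReal (Real.exp (l i * x)))
      (fun i => by fun_prop)) (fun i => by have := hm; fun_prop)]
  refine Finset.prod_congr rfl fun i _ => ?_
  have hle : p i.castSucc ≤ p i.succ := hp (Fin.castSucc_le_succ i)
  have hid := hσ.stationary_increments (p i.castSucc) (p i.succ - p i.castSucc)
  rw [add_tsub_cancel_of_le hle] at hid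
  have h := (hid.comp (u := fun x => ENNReal.ofReal (Real.exp (l i * x))) (by fun_prop)).lintegral_eq
  simp only [Function.comp_def] at h
  rw [h, hσ.lintegral_exp_temperedStable hα0 hα1 _ (hl i), NNReal.coe_sub hle]

/-- Conditioning on the clock: by independence the joint law of path and clock is a product, and at
a frozen clock value the times are deterministic, so `IsSubordinator.lintegral_exp_increments`
applies. -/
theorem lintegral_exp_rescaledIncrements_eq_gammaTime (hα0 : 0 < α) (hα1 : α < 1)
    {Pi : Measure ℝ} (hσ : IsSubordinator P σ (temperedStableLevy α)) (hτ : IsSubordinator P τ Pi)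
    (hστ : IndepFun (fun ω t => σ t ω) (fun ω t => τ t ω) P) {a : Fin n → ℝ} (ha : ∀ i, 0 ≤ a i)
    {θ : ℝ} (hθ : 0 < θ) {l : Fin n → ℝ} (hl : ∀ i, l i ≤ 1) :
    ∫⁻ ω, ENNReal.ofReal (Real.exp
      (θ * ∑ i, l i * (rescaledIncrements α a σ τ θ ω i : ℝ))) ∂P =
    ∫⁻ ω, ENNReal.ofReal (Real.exp (gammaTime α τ θ ω *
      ∑ i, a i * (Real.Gamma (1 - α) / α) * (1 - (1 - l i) ^ α))) ∂P := by
  set U : Ω → ℝ≥0 → ℝ≥0 := fun ω t => σ t ω with hU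
  set V : Ω → ℝ≥0 := fun ω => Real.toNNReal (gammaTime α τ θ ω) with hV
  have hUm : Measurable U := measurable_path hσ
  have hVm : Measurable V := (measurable_gammaTime hτ θ).real_toNNReal
  have hVcoe (ω : Ω) : (V ω : ℝ) = gammaTime α τ θ ω :=
    Real.coe_toNNReal _ (gammaTime_nonneg hα0 hα1 θ ω)
  have hUV : IndepFun U V P := by
    have hφ : Measurable fun w : ℝ≥0 → ℝ≥0 =>
        Real.toNNReal (α * (w (Real.toNNReal (θ / α)) : ℝ) / Real.Gamma (1 - α)) := by fun_prop
    exact hστ.comp measurable_id hφ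
  let K : (ℝ≥0 → ℝ≥0) × ℝ≥0 → ℝ≥0∞ := fun q => ENNReal.ofReal (Real.exp
      (θ * ∑ i, l i * (incrementMap (partialMass a) θ q i : ℝ)))
  have hKm : Measurable K := by
    have h (i : Fin n) : Measurable fun q => (incrementMap (partialMass a) θ q i : ℝ) :=
      ((measurable_pi_apply i).comp (measurable_incrementMap _ _)).coe_nnreal_real
    fun_prop
  have h1 : ∫⁻ ω, ENNReal.ofReal (Real.exp
      (θ * ∑ i, l i * (rescaledIncrements α a σ τ θ ω i : ℝ))) ∂P = ∫⁻ ω, K (U ω, V ω) ∂P := by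
    refine lintegral_congr_ae ?_
    filter_upwards [rescaledIncrements_ae_eq (τ := τ) hα0 hα1 hσ a θ] with ω hω
    rw [hω]
  rw [h1, ← lintegral_map (f := K) hKm (hUm.prodMk hVm),
    (indepFun_iff_map_prod_eq_prod_map_map hUm.aemeasurable hVm.aemeasurable).1 hUV,
    lintegral_prod_symm _ hKm.aemeasurable, lintegral_map (hKm.lintegral_prod_left') hVm]
  refine lintegral_congr fun ω' => ?_
  rw [lintegral_map (by fun_prop) hUm, ← hVcoe]
  have hp : Monotone fun k => Real.toNNReal (V ω' * partialMass a k) := fun j k hjk =>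
    Real.toNNReal_le_toNNReal (mul_le_mul_of_nonneg_left (monotone_partialMass ha hjk)
      (NNReal.coe_nonneg _))
  have hcoe (k : Fin (n + 1)) : (Real.toNNReal (V ω' * partialMass a k) : ℝ) =
      V ω' * partialMass a k := by
    refine Real.coe_toNNReal _ (mul_nonneg (NNReal.coe_nonneg _) ?_)
    rw [← partialMass_zero a]
    exact monotone_partialMass ha (Fin.zero_le k)
  have h2 := hσ.lintegral_exp_increments hα0 hα1 hp hl
  have hdiff (i : Fin n) : (Real.toNNReal (V ω' * partialMass a i.succ) : ℝ) -
      Real.toNNReal (V ω' * partialMass a i.castSucc) = V ω' * a i := by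
    rw [hcoe, hcoe, partialMass_succ]; ring
  simp only [hdiff, mul_assoc] at h2
  rw [Finset.mul_sum]
  simp only [mul_assoc]
  rw [← h2]
  refine lintegral_congr_ae ?_
  -- Right continuity turns `rightEval` into true evaluation; monotonicity makes the truncation
  -- `Real.toNNReal` harmless.
  filter_upwards [hσ.rightContinuous_paths, hσ.monotone_paths] with ω hω hmono
  simp only [K]
  congr 2
  rw [Finset.mul_sum]
  refine Finset.sum_congr rfl fun i _ => ?_
  have hnn : (0 : ℝ) ≤ (σ (Real.toNNReal (V ω' * partialMass a i.succ)) ω : ℝ) -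
      σ (Real.toNNReal (V ω' * partialMass a i.castSucc)) ω :=
    sub_nonneg.2 (NNReal.coe_le_coe.2 (hmono (hp (Fin.castSucc_le_succ i))))
  simp only [incrementMap, hU, rightEval_eq (hω _)]
  rw [Real.coe_toNNReal _ (by positivity), partialMass_succ]
  field_simp

/-- The constants in `γ` and `ψ` cancel, leaving the moment of `τ(θ/α)` at exponent `1 - S`; `hS`
says precisely that this lies below the critical value `1`. -/
theorem lintegral_exp_rescaledIncrements (hα0 : 0 < α) (hα1 : α < 1)
    (hσ : IsSubordinator P σ (temperedStableLevy α)) (hτ : IsSubordinator P τ gammaLevy)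
    (hστ : IndepFun (fun ω t => σ t ω) (fun ω t => τ t ω) P) {a : Fin n → ℝ} (ha : ∀ i, 0 ≤ a i)
    (hsum : ∑ i, a i = 1) {θ : ℝ} (hθ : 0 < θ) {l : Fin n → ℝ} (hl : ∀ i, l i ≤ 1)
    (hS : 0 < ∑ i, a i * (1 - l i) ^ α) :
    ∫⁻ ω, ENNReal.ofReal (Real.exp
      (θ * ∑ i, l i * (rescaledIncrements α a σ τ θ ω i : ℝ))) ∂P =
    ENNReal.ofReal (Real.exp (-(θ * (1 / α * Real.log (∑ i, a i * (1 - l i) ^ α))))) := by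
  have hΓ : 0 < Real.Gamma (1 - α) := Real.Gamma_pos_of_pos (by linarith)
  rw [lintegral_exp_rescaledIncrements_eq_gammaTime hα0 hα1 hσ hτ hστ ha hθ hl]
  have h1 (ω : Ω) : gammaTime α τ θ ω * ∑ i, a i * (Real.Gamma (1 - α) / α) * (1 - (1 - l i) ^ α) =
      (1 - ∑ i, a i * (1 - l i) ^ α) * (τ (Real.toNNReal (θ / α)) ω : ℝ) := by
    have : ∑ i, a i * (Real.Gamma (1 - α) / α) * (1 - (1 - l i) ^ α) =
        (Real.Gamma (1 - α) / α) * (1 - ∑ i, a i * (1 - l i) ^ α) := by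
      calc _ = Real.Gamma (1 - α) / α * (∑ i, a i - ∑ i, a i * (1 - l i) ^ α) := by
            rw [← Finset.sum_sub_distrib, Finset.mul_sum]
            exact Finset.sum_congr rfl fun i _ => by ring
        _ = _ := by rw [hsum]
    rw [this, gammaTime]
    field_simp
  simp_rw [h1]
  rw [hτ.lintegral_exp_gamma _ (by linarith), sub_sub_cancel, Real.coe_toNNReal _ (by positivity)]
  congr 3
  field_simp

end Increments

/-! ### A large deviation principle from exponential moments -/

theorem inv_mul_log_le {θ r : ℝ} (hθ : 0 < θ) {m : ℝ≥0∞} (h : m ≤ ENNReal.ofReal (Real.exp (θ * r))) :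
    ((1 / θ : ℝ) : EReal) * ENNReal.log m ≤ r := by
  have h1 := ENNReal.log_monotone h
  rw [ENNReal.log_ofReal_of_pos (Real.exp_pos _), Real.log_exp] at h1
  refine (mul_le_mul_of_nonneg_left h1 (EReal.coe_nonneg.2 (by positivity))).trans_eq ?_
  rw [← EReal.coe_mul]
  congr 1
  field_simp

theorem le_inv_mul_log {θ r : ℝ} (hθ : 0 < θ) {m : ℝ≥0∞} (h : ENNReal.ofReal (Real.exp (θ * r)) ≤ m) :
    (r : EReal) ≤ ((1 / θ : ℝ) : EReal) * ENNReal.log m := by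
  have h1 := ENNReal.log_monotone h
  rw [ENNReal.log_ofReal_of_pos (Real.exp_pos _), Real.log_exp] at h1
  refine le_trans (le_of_eq ?_) (mul_le_mul_of_nonneg_left h1 (EReal.coe_nonneg.2 (by positivity)))
  rw [← EReal.coe_mul]
  congr 1
  field_simp

section Legendre

variable {n : ℕ}

/-- The Legendre transform of `Λ : D → ℝ`, as a function on `R_+^n`. -/
noncomputable def legendre (D : Set (Fin n → ℝ)) (Λ : (Fin n → ℝ) → ℝ) (y : Fin n → ℝ≥0) : EReal :=
  ⨆ l ∈ D, ((∑ i, l i * (y i : ℝ) - Λ l : ℝ) : EReal)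

variable {D : Set (Fin n → ℝ)} {Λ : (Fin n → ℝ) → ℝ}

theorem le_legendre {l : Fin n → ℝ} (hl : l ∈ D) (y : Fin n → ℝ≥0) :
    ((∑ i, l i * (y i : ℝ) - Λ l : ℝ) : EReal) ≤ legendre D Λ y :=
  le_iSup₂ (f := fun l (_ : l ∈ D) => ((∑ i, l i * (y i : ℝ) - Λ l : ℝ) : EReal)) l hl

theorem lowerSemicontinuous_legendre : LowerSemicontinuous (legendre D Λ) :=
  lowerSemicontinuous_biSup fun l _ => Continuous.lowerSemicontinuous
    (continuous_coe_real_ereal.comp (by fun_prop))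

theorem exists_smul_single_mem (hD : D ∈ 𝓝 0) :
    ∃ ε : ℝ, 0 < ε ∧ ∀ i, Pi.single i ε ∈ D := by
  have h (i : Fin n) : ∀ᶠ ε : ℝ in 𝓝[>] 0, (Pi.single i ε : Fin n → ℝ) ∈ D := by
    have hc : Continuous fun ε : ℝ => (Pi.single i ε : Fin n → ℝ) := continuous_single (A := fun _ : Fin n => ℝ) i
    have h0 := hc.tendsto 0
    rw [Pi.single_zero] at h0
    exact (h0.mono_left nhdsWithin_le_nhds).eventually hD
  obtain ⟨ε, h1, h2⟩ := ((eventually_all.2 h).and self_mem_nhdsWithin).exists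
  exact ⟨ε, h2, h1⟩

/-- Outside a compact box the linear functionals from a finite subset of `D` are large. -/
theorem exists_finset_forall_notMem_Icc (hD : D ∈ 𝓝 0) (m : ℝ) :
    ∃ T : Finset (Fin n → ℝ), ↑T ⊆ D ∧ ∃ R : ℝ≥0, ∀ z : Fin n → ℝ≥0, z ∉ Icc 0 (fun _ => R) →
      ∃ l ∈ T, m < ∑ i, l i * (z i : ℝ) - Λ l := by
  classical
  obtain ⟨ε, hε, hmem⟩ := exists_smul_single_mem hD
  -- Chosen so that `z i > r i` gives `ε z_i - Λ(ε e_i) > m`. The sum of the `r i` serves as a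
  -- common upper bound.
  let r : Fin n → ℝ≥0 := fun i => Real.toNNReal ((m + Λ (Pi.single i ε)) / ε)
  refine ⟨Finset.univ.image fun i => Pi.single i ε, ?_, ∑ i, r i, fun z hz => ?_⟩
  · intro l hl
    obtain ⟨i, -, rfl⟩ := Finset.mem_image.1 hl
    exact hmem i
  · have : ∃ i, ∑ j, r j < z i := by
      by_contra hcon
      push Not at hcon
      exact hz ⟨fun i => zero_le, hcon⟩
    obtain ⟨i, hi⟩ := this
    refine ⟨Pi.single i ε, Finset.mem_image_of_mem _ (Finset.mem_univ i), ?_⟩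
    have h1 : r i < z i := (Finset.single_le_sum (fun _ _ => zero_le) (Finset.mem_univ i)).trans_lt hi
    have h2 : (m + Λ (Pi.single i ε)) / ε < z i :=
      (Real.le_coe_toNNReal _).trans_lt (NNReal.coe_lt_coe.2 h1)
    rw [div_lt_iff₀ hε] at h2
    have h3 : ∑ j, (Pi.single i ε : Fin n → ℝ) j * (z j : ℝ) = ε * z i := by
      rw [Finset.sum_eq_single i (fun j _ hj => by simp [hj]) (by simp)]
      simp
    rw [h3]
    linarith

theorem isCompact_sublevel_legendre (hD : D ∈ 𝓝 0) (c : ℝ) :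
    IsCompact {y | legendre D Λ y ≤ (c : EReal)} := by
  obtain ⟨T, hTD, R, hR⟩ := exists_finset_forall_notMem_Icc (Λ := Λ) hD c
  refine (isCompact_Icc (a := 0) (b := fun _ => R)).of_isClosed_subset
    (lowerSemicontinuous_legendre.isClosed_preimage _) fun y hy => ?_
  by_contra hcon
  obtain ⟨l, hl, hlt⟩ := hR y hcon
  have := (le_legendre (Λ := Λ) (hTD hl) y).trans hy
  exact absurd (EReal.coe_le_coe_iff.1 this) (not_le.2 hlt)

/-- Open half-spaces cover the part of `F` in a compact box, hence finitely many do; the coordinate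
directions handle the rest. This gives the upper bound for all closed sets without a separate
exponential tightness argument. -/
theorem exists_finset_cover (hD : D ∈ 𝓝 0) {F : Set (Fin n → ℝ≥0)} (hF : IsClosed F) {m : ℝ}
    (hm : (m : EReal) < ⨅ y ∈ F, legendre D Λ y) :
    ∃ T : Finset (Fin n → ℝ), ↑T ⊆ D ∧
      F ⊆ ⋃ l ∈ T, {z | m < ∑ i, l i * (z i : ℝ) - Λ l} := by
  classical
  obtain ⟨T, hTD, R, hR⟩ := exists_finset_forall_notMem_Icc (Λ := Λ) hD m
  have hK : IsCompact (F ∩ Icc 0 fun _ => R) := isCompact_Icc.inter_left hF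
  obtain ⟨b, hbD, hbfin, hb⟩ := hK.elim_finite_subcover_image (b := D)
    (c := fun l => {z : Fin n → ℝ≥0 | m < ∑ i, l i * (z i : ℝ) - Λ l})
    (fun l _ => isOpen_lt continuous_const (by fun_prop)) fun z hz => by
      have h1 : (m : EReal) < legendre D Λ z := hm.trans_le (iInf₂_le z hz.1)
      simp only [legendre, lt_iSup_iff] at h1
      obtain ⟨l, hl, hlt⟩ := h1
      exact mem_iUnion₂.2 ⟨l, hl, EReal.coe_lt_coe_iff.1 hlt⟩
  refine ⟨T ∪ hbfin.toFinset, ?_, fun z hz => ?_⟩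
  · intro l hl
    simp only [Finset.coe_union, Finite.coe_toFinset] at hl
    exact hl.elim (fun h => hTD h) fun h => hbD h
  · by_cases hzI : z ∈ Icc 0 fun _ => R
    · obtain ⟨l, hl, hlz⟩ := mem_iUnion₂.1 (hb ⟨hz, hzI⟩)
      exact mem_iUnion₂.2 ⟨l, by simp [hl], hlz⟩
    · obtain ⟨l, hl, hlz⟩ := hR z hzI
      exact mem_iUnion₂.2 ⟨l, by simp [hl], hlz⟩

variable {μ : ℝ → Measure (Fin n → ℝ≥0)}

/-- Chernoff's bound. -/
theorem measure_halfSpace_le {θ : ℝ} (hθ : 0 < θ) {l : Fin n → ℝ}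
    (hmom : ∫⁻ z, ENNReal.ofReal (Real.exp (θ * ∑ i, l i * (z i : ℝ))) ∂(μ θ) =
      ENNReal.ofReal (Real.exp (θ * Λ l))) (m : ℝ) :
    μ θ {z | m < ∑ i, l i * (z i : ℝ) - Λ l} ≤ ENNReal.ofReal (Real.exp (-(θ * m))) := by
  have hmeas : MeasurableSet {z : Fin n → ℝ≥0 | m < ∑ i, l i * (z i : ℝ) - Λ l} :=
    measurableSet_lt measurable_const (by fun_prop)
  calc μ θ {z | m < ∑ i, l i * (z i : ℝ) - Λ l}
      = ∫⁻ z, indicator {z | m < ∑ i, l i * (z i : ℝ) - Λ l} 1 z ∂(μ θ) :=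
        (lintegral_indicator_one hmeas).symm
    _ ≤ ∫⁻ z, ENNReal.ofReal (Real.exp (-(θ * (m + Λ l)))) *
          ENNReal.ofReal (Real.exp (θ * ∑ i, l i * (z i : ℝ))) ∂(μ θ) := by
        refine lintegral_mono fun z => ?_
        rw [indicator_apply]
        split_ifs with hz
        swap
        · exact zero_le
        have hz' : m < ∑ i, l i * (z i : ℝ) - Λ l := hz
        rw [← ENNReal.ofReal_mul (Real.exp_pos _).le, ← Real.exp_add, Pi.one_apply,
          ENNReal.one_le_ofReal, Real.one_le_exp_iff]
        nlinarith
    _ = ENNReal.ofReal (Real.exp (-(θ * m))) := by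
        rw [lintegral_const_mul _ (by fun_prop), hmom, ← ENNReal.ofReal_mul (Real.exp_pos _).le,
          ← Real.exp_add]
        congr 2; ring

theorem eventually_le_mul_of_pos {c : ℝ} (hc : 0 < c) (b : ℝ) : ∀ᶠ θ : ℝ in atTop, b ≤ θ * c :=
  (tendsto_id.atTop_mul_const hc).eventually_ge_atTop b

theorem legendre_upper_bound (hD : D ∈ 𝓝 0)
    (hmom : ∀ θ, 0 < θ → ∀ l ∈ D, ∫⁻ z, ENNReal.ofReal (Real.exp (θ * ∑ i, l i * (z i : ℝ))) ∂(μ θ) =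
      ENNReal.ofReal (Real.exp (θ * Λ l)))
    {F : Set (Fin n → ℝ≥0)} (hF : IsClosed F) :
    limsup (fun θ : ℝ => ((1 / θ : ℝ) : EReal) * ENNReal.log (μ θ F)) atTop ≤
      -(⨅ y ∈ F, legendre D Λ y) := by
  rw [EReal.le_neg]
  refine EReal.ge_of_forall_gt_iff_ge.1 fun m hm => ?_
  rw [EReal.le_neg, ← EReal.coe_neg]
  -- The gap `m' - m` absorbs the number of half-spaces, which does not depend on `θ`.
  obtain ⟨m', hm1, hm2⟩ := EReal.lt_iff_exists_real_btwn.1 hm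
  have hlt : m < m' := EReal.coe_lt_coe_iff.1 hm1
  obtain ⟨T, hTD, hT⟩ := exists_finset_cover hD hF hm2
  refine limsup_le_of_le (h := ?_)
  filter_upwards [eventually_gt_atTop 0,
    eventually_le_mul_of_pos (sub_pos.2 hlt) (Real.log (T.card + 1))] with θ hθ hbig
  refine inv_mul_log_le hθ ?_
  have hcard : (T.card : ℝ) ≤ Real.exp (θ * (m' - m)) := by
    have := (Real.log_le_iff_le_exp (by positivity)).1 hbig
    linarith
  calc μ θ F ≤ ∑ l ∈ T, μ θ {z | m' < ∑ i, l i * (z i : ℝ) - Λ l} :=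
        (measure_mono hT).trans (measure_biUnion_finset_le _ _)
    _ ≤ ∑ l ∈ T, ENNReal.ofReal (Real.exp (-(θ * m'))) :=
        Finset.sum_le_sum fun l hl => measure_halfSpace_le hθ (hmom θ hθ l (hTD hl)) m'
    _ = ENNReal.ofReal (T.card * Real.exp (-(θ * m'))) := by
        rw [Finset.sum_const, nsmul_eq_mul, ENNReal.ofReal_mul (by positivity),
          ENNReal.ofReal_natCast]
    _ ≤ ENNReal.ofReal (Real.exp (θ * -m)) := by
        refine ENNReal.ofReal_le_ofReal
          ((mul_le_mul_of_nonneg_right hcard (Real.exp_pos _).le).trans_eq ?_)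
        rw [← Real.exp_add]
        congr 1; ring

/-- Under the measure tilted by `l`, the mass outside a box around the gradient `y` of `Λ` at `l`
is exponentially small. -/
theorem exists_tilted_tail_le {l : Fin n → ℝ} (hl : D ∈ 𝓝 l) {y : Fin n → ℝ≥0}
    (hy : ∀ i, HasDerivAt (fun s : ℝ => Λ (l + Pi.single i s)) (y i) 0)
    (hmom : ∀ θ, 0 < θ → ∀ l ∈ D, ∫⁻ z, ENNReal.ofReal (Real.exp (θ * ∑ i, l i * (z i : ℝ))) ∂(μ θ) =
      ENNReal.ofReal (Real.exp (θ * Λ l)))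
    {δ : ℝ} (hδ : 0 < δ) :
    ∃ κ : ℝ, 0 < κ ∧ ∀ θ, 0 < θ → ∀ i,
      ∫⁻ z in {z | δ ≤ |(z i : ℝ) - y i|},
        ENNReal.ofReal (Real.exp (θ * (∑ j, l j * (z j : ℝ) - Λ l))) ∂(μ θ) ≤
      ENNReal.ofReal (2 * Real.exp (-(θ * κ))) := by
  have hsmall (i : Fin n) : ∀ᶠ s : ℝ in 𝓝 0, l + Pi.single i s ∈ D ∧
      Λ (l + Pi.single i s) - Λ l - s * y i ≤ δ / 2 * |s| := by
    have hc : Continuous fun s : ℝ => l + (Pi.single i s : Fin n → ℝ) :=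
      continuous_const.add (continuous_single (A := fun _ : Fin n => ℝ) i)
    have h0 := hc.tendsto 0
    rw [Pi.single_zero, add_zero] at h0
    filter_upwards [h0.eventually hl, (hy i).isLittleO.def (half_pos hδ)] with s h1 h2
    refine ⟨h1, ?_⟩
    rw [Pi.single_zero, add_zero, sub_zero, smul_eq_mul, Real.norm_eq_abs, Real.norm_eq_abs] at h2
    exact (le_abs_self _).trans h2
  have hpos := (eventually_all.2 hsmall).filter_mono (nhdsWithin_le_nhds (s := Ioi 0))
  have hneg : ∀ᶠ s : ℝ in 𝓝[>] 0, ∀ i, l + Pi.single i (-s) ∈ D ∧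
      Λ (l + Pi.single i (-s)) - Λ l - -s * y i ≤ δ / 2 * |-s| := by
    have : Tendsto (fun s : ℝ => -s) (𝓝[>] 0) (𝓝 0) := by
      simpa using (continuous_neg.tendsto (0 : ℝ)).mono_left nhdsWithin_le_nhds
    exact this.eventually (eventually_all.2 hsmall)
  obtain ⟨ε, ⟨h1, h2⟩, hε⟩ := ((hpos.and hneg).and self_mem_nhdsWithin).exists
  have hε : 0 < ε := hε
  -- Chernoff at `l ± ε e_i`: a deviation `δ` gains `ε δ`, while the first-order expansion of `Λ`
  -- costs at most `ε δ / 2`. The factor `2` accounts for the two signs.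
  refine ⟨ε * δ / 2, by positivity, fun θ hθ i => ?_⟩
  have hsingle (s : ℝ) (z : Fin n → ℝ≥0) : ∑ j, (l + Pi.single i s : Fin n → ℝ) j * (z j : ℝ) =
      ∑ j, l j * (z j : ℝ) + s * z i := by
    simp only [Pi.add_apply, add_mul, Finset.sum_add_distrib]
    congr 1
    rw [Finset.sum_eq_single i (fun j _ hj => by simp [hj]) (by simp)]
    simp
  have key (s : ℝ) (hs : |s| = ε) (hsD : l + Pi.single i s ∈ D)
      (hsΛ : Λ (l + Pi.single i s) - Λ l - s * y i ≤ δ / 2 * |s|) :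
      ∫⁻ z, ENNReal.ofReal (Real.exp (θ * (-Λ l - s * y i - ε * δ))) *
        ENNReal.ofReal (Real.exp (θ * ∑ j, (l + Pi.single i s : Fin n → ℝ) j * (z j : ℝ))) ∂(μ θ) ≤
      ENNReal.ofReal (Real.exp (-(θ * (ε * δ / 2)))) := by
    rw [lintegral_const_mul _ (by fun_prop), hmom θ hθ _ hsD,
      ← ENNReal.ofReal_mul (Real.exp_pos _).le, ← Real.exp_add]
    refine ENNReal.ofReal_le_ofReal (Real.exp_le_exp.2 ?_)
    rw [hs] at hsΛ
    nlinarith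
  have hmeas : MeasurableSet {z : Fin n → ℝ≥0 | δ ≤ |(z i : ℝ) - y i|} :=
    measurableSet_le measurable_const (by fun_prop)
  rw [two_mul, ENNReal.ofReal_add (Real.exp_pos _).le (Real.exp_pos _).le]
  refine le_trans ?_ (add_le_add (key ε (abs_of_pos hε) (h1 i).1 (h1 i).2)
    (key (-ε) (by rw [abs_neg, abs_of_pos hε]) (h2 i).1 (h2 i).2))
  rw [← lintegral_add_left (by fun_prop)]
  refine (setLIntegral_mono' hmeas fun z (hz : δ ≤ _) => ?_).trans (setLIntegral_le_lintegral _ _)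
  simp only [← ENNReal.ofReal_mul (Real.exp_pos _).le, ← Real.exp_add, hsingle]
  rcases le_abs.1 hz with hz | hz
  · refine le_trans (ENNReal.ofReal_le_ofReal (Real.exp_le_exp.2 ?_)) le_self_add
    have := mul_le_mul_of_nonneg_left hz (mul_pos hθ hε).le
    nlinarith
  · refine le_trans (ENNReal.ofReal_le_ofReal (Real.exp_le_exp.2 ?_)) le_add_self
    have := mul_le_mul_of_nonneg_left hz (mul_pos hθ hε).le
    nlinarith

theorem exists_box_subset {G : Set (Fin n → ℝ≥0)} (hG : IsOpen G) {y : Fin n → ℝ≥0} (hy : y ∈ G) :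
    ∃ r : ℝ, 0 < r ∧ ∀ z : Fin n → ℝ≥0, (∀ i, |(z i : ℝ) - y i| < r) → z ∈ G := by
  obtain ⟨r, hr, hsub⟩ := Metric.isOpen_iff.1 hG y hy
  refine ⟨r, hr, fun z hz => hsub ?_⟩
  rw [Metric.mem_ball, dist_pi_lt_iff hr]
  intro i
  rw [NNReal.dist_eq]
  exact hz i

/-- Cramér's change of measure: under the tilt by `l` a small box around `y` keeps mass at least
`1/2`, and on that box the tilting density is at most `exp(θ (K + δ N))`. -/
theorem legendre_local_lower_bound {l : Fin n → ℝ} (hl : D ∈ 𝓝 l) {y : Fin n → ℝ≥0}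
    (hy : ∀ i, HasDerivAt (fun s : ℝ => Λ (l + Pi.single i s)) (y i) 0)
    (hmom : ∀ θ, 0 < θ → ∀ l ∈ D, ∫⁻ z, ENNReal.ofReal (Real.exp (θ * ∑ i, l i * (z i : ℝ))) ∂(μ θ) =
      ENNReal.ofReal (Real.exp (θ * Λ l)))
    {G : Set (Fin n → ℝ≥0)} (hG : IsOpen G) (hyG : y ∈ G) {r : ℝ}
    (hr : r < -(∑ i, l i * (y i : ℝ) - Λ l)) :
    ∀ᶠ θ : ℝ in atTop, ENNReal.ofReal (Real.exp (θ * r)) ≤ μ θ G := by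
  obtain ⟨r₀, hr₀, hbox⟩ := exists_box_subset hG hyG
  set K := ∑ i, l i * (y i : ℝ) - Λ l with hK
  set N := ∑ i, |l i| with hN
  have hN0 : 0 ≤ N := Finset.sum_nonneg fun i _ => abs_nonneg _
  have hgap : 0 < -K - r := by linarith
  -- Half of the gap pays for the oscillation of the tilt on the box, the other half for the factor
  -- `1/2`. Dividing by `N + 1` below allows `N = 0`.
  obtain ⟨δ, hδ, hδr, hδN⟩ : ∃ δ, 0 < δ ∧ δ ≤ r₀ ∧ δ * N ≤ (-K - r) / 2 := by
    refine ⟨min r₀ ((-K - r) / 2 / (N + 1)), by positivity, min_le_left _ _, ?_⟩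
    calc min r₀ ((-K - r) / 2 / (N + 1)) * N ≤ (-K - r) / 2 / (N + 1) * (N + 1) := by
          gcongr
          · exact min_le_right _ _
          · linarith
      _ = _ := by field_simp
  obtain ⟨κ, hκ, htail⟩ := exists_tilted_tail_le hl hy hmom hδ
  let B : Set (Fin n → ℝ≥0) := {z | ∀ i, |(z i : ℝ) - y i| < δ}
  have hBm : MeasurableSet B := by
    simp only [B, ofPred_forall]
    exact MeasurableSet.iInter fun i => measurableSet_lt (by fun_prop) measurable_const
  have hBc : Bᶜ ⊆ ⋃ i, {z | δ ≤ |(z i : ℝ) - y i|} := fun z hz => by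
    simp only [B, mem_compl_iff, mem_ofPred_eq, not_forall, not_lt] at hz
    exact mem_iUnion.2 hz
  -- `exp(θ κ) ≥ 4 n` makes the `n` tails, each at most `2 exp(-θ κ)`, sum to at most `1/2`.
  filter_upwards [eventually_gt_atTop 0, eventually_le_mul_of_pos hκ (Real.log (4 * n + 1)),
    eventually_le_mul_of_pos (half_pos hgap) (Real.log 2)] with θ hθ hθ1 hθ2
  let w : (Fin n → ℝ≥0) → ℝ≥0∞ := fun z =>
    ENNReal.ofReal (Real.exp (θ * (∑ j, l j * (z j : ℝ) - Λ l)))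
  have htotal : ∫⁻ z, w z ∂(μ θ) = 1 := by
    have h1 (z : Fin n → ℝ≥0) : w z = ENNReal.ofReal (Real.exp (-(θ * Λ l))) *
        ENNReal.ofReal (Real.exp (θ * ∑ j, l j * (z j : ℝ))) := by
      rw [← ENNReal.ofReal_mul (Real.exp_pos _).le, ← Real.exp_add]
      simp only [w]
      congr 2; ring
    simp_rw [h1]
    rw [lintegral_const_mul _ (by fun_prop), hmom θ hθ l (mem_of_mem_nhds hl),
      ← ENNReal.ofReal_mul (Real.exp_pos _).le, ← Real.exp_add]
    simp
  have hout : ∫⁻ z in Bᶜ, w z ∂(μ θ) ≤ ENNReal.ofReal (1 / 2) := by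
    calc ∫⁻ z in Bᶜ, w z ∂(μ θ)
        ≤ ∑ i, ∫⁻ z in {z | δ ≤ |(z i : ℝ) - y i|}, w z ∂(μ θ) := by
          refine (lintegral_mono_set hBc).trans ((lintegral_iUnion_le _ _).trans_eq ?_)
          rw [tsum_fintype]
      _ ≤ ∑ _i : Fin n, ENNReal.ofReal (2 * Real.exp (-(θ * κ))) :=
          Finset.sum_le_sum fun i _ => htail θ hθ i
      _ = ENNReal.ofReal (n * (2 * Real.exp (-(θ * κ)))) := by
          rw [Finset.sum_const, nsmul_eq_mul, ENNReal.ofReal_mul (p := (n : ℝ)) (by positivity),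
            ENNReal.ofReal_natCast, Finset.card_univ, Fintype.card_fin]
      _ ≤ ENNReal.ofReal (1 / 2) := by
          refine ENNReal.ofReal_le_ofReal ?_
          have h1 := (Real.log_le_iff_le_exp (by positivity)).1 hθ1
          rw [Real.exp_neg, ← div_eq_mul_inv, ← mul_div_assoc, div_le_iff₀ (Real.exp_pos _)]
          linarith
  have hin : ENNReal.ofReal (1 / 2) ≤ ∫⁻ z in B, w z ∂(μ θ) := by
    have h1 := lintegral_add_compl (μ := μ θ) w hBm
    rw [htotal] at h1
    have h2 : (1 : ℝ≥0∞) = ENNReal.ofReal (1 / 2) + ENNReal.ofReal (1 / 2) := by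
      rw [← ENNReal.ofReal_add (by norm_num) (by norm_num)]; norm_num
    rw [h2] at h1
    by_contra hcon
    exact absurd h1 (ENNReal.add_lt_add_of_lt_of_le
      (ne_top_of_le_ne_top ENNReal.ofReal_ne_top hout) (not_le.1 hcon) hout).ne
  have hwB : ∫⁻ z in B, w z ∂(μ θ) ≤ ENNReal.ofReal (Real.exp (θ * (K + δ * N))) * μ θ B := by
    rw [← setLIntegral_const]
    refine setLIntegral_mono' hBm fun z hz => ENNReal.ofReal_le_ofReal (Real.exp_le_exp.2 ?_)
    refine mul_le_mul_of_nonneg_left ?_ hθ.le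
    have : ∑ i, l i * (z i : ℝ) - ∑ i, l i * (y i : ℝ) ≤ δ * N := by
      rw [hN, Finset.mul_sum, ← Finset.sum_sub_distrib]
      refine Finset.sum_le_sum fun i _ => ?_
      rw [← mul_sub, mul_comm δ]
      refine (le_abs_self _).trans ?_
      rw [abs_mul]
      exact mul_le_mul_of_nonneg_left (hz i).le (abs_nonneg _)
    linarith
  calc ENNReal.ofReal (Real.exp (θ * r))
      ≤ ENNReal.ofReal (Real.exp (-(θ * (K + δ * N)))) * ENNReal.ofReal (1 / 2) := by
        rw [← ENNReal.ofReal_mul (Real.exp_pos _).le]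
        refine ENNReal.ofReal_le_ofReal ?_
        have h2 := (Real.log_le_iff_le_exp two_pos).1 hθ2
        have h3 : Real.exp (θ * r) * Real.exp (θ * ((-K - r) / 2)) ≤ Real.exp (-(θ * (K + δ * N))) := by
          rw [← Real.exp_add]
          refine Real.exp_le_exp.2 ?_
          nlinarith
        nlinarith [Real.exp_pos (θ * r)]
    _ ≤ ENNReal.ofReal (Real.exp (-(θ * (K + δ * N)))) *
        (ENNReal.ofReal (Real.exp (θ * (K + δ * N))) * μ θ B) := by
        gcongr
        exact hin.trans hwB
    _ = μ θ B := by
        rw [← mul_assoc, ← ENNReal.ofReal_mul (Real.exp_pos _).le, ← Real.exp_add]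
        simp
    _ ≤ μ θ G := measure_mono fun z hz => hbox z fun i => (hz i).trans_le hδr

/-- If the exponential moments of `μ θ` are `exp (θ Λ)` on a neighbourhood `D` of `0`, and every
point at which the Legendre transform is finite is a gradient of `Λ` in the interior of `D`, then
the large deviation principle holds. -/
theorem satisfiesLDP_legendre (hD : D ∈ 𝓝 0) (hΛ : Λ 0 = 0)
    (hmom : ∀ θ, 0 < θ → ∀ l ∈ D, ∫⁻ z, ENNReal.ofReal (Real.exp (θ * ∑ i, l i * (z i : ℝ))) ∂(μ θ) =
      ENNReal.ofReal (Real.exp (θ * Λ l)))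
    (hgrad : ∀ y, legendre D Λ y ≠ ⊤ → ∃ l, D ∈ 𝓝 l ∧
      ∀ i, HasDerivAt (fun s : ℝ => Λ (l + Pi.single i s)) (y i) 0) :
    SatisfiesLDP μ (legendre D Λ) where
  nonneg y := by
    have := le_legendre (Λ := Λ) (mem_of_mem_nhds hD) y
    simpa [hΛ] using this
  lowerSemicontinuous := lowerSemicontinuous_legendre
  isCompact_sublevel := isCompact_sublevel_legendre hD
  upper_bound _ hF := legendre_upper_bound hD hmom hF
  lower_bound G hG := by
    rw [EReal.neg_le]
    refine le_iInf₂ fun y hyG => ?_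
    by_cases htop : legendre D Λ y = ⊤
    · rw [htop]; exact le_top
    obtain ⟨l, hl, hy⟩ := hgrad y htop
    rw [EReal.neg_le]
    -- It suffices that the value at `l` is at most the supremum, so convexity of `Λ` is not needed.
    refine (EReal.neg_le_neg_iff.2 (le_legendre (Λ := Λ) (mem_of_mem_nhds hl) y)).trans ?_
    rw [← EReal.coe_neg]
    refine EReal.ge_of_forall_gt_iff_ge.1 fun r hr => ?_
    refine le_liminf_of_le (h := ?_)
    filter_upwards [eventually_gt_atTop 0, legendre_local_lower_bound hl hy hmom hG hyG
      (EReal.coe_lt_coe_iff.1 hr)] with θ hθ h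
    exact le_inv_mul_log hθ h

end Legendre

/-! ### The rate function -/

section Rate

variable {n : ℕ} {α : ℝ} {a : Fin n → ℝ}

/-- `S(l) = ∑ a_i (1 - l_i)^α`. -/
noncomputable def powerSum (α : ℝ) (a l : Fin n → ℝ) : ℝ := ∑ i, a i * (1 - l i) ^ α

/-- The effective domain of `Λ`. -/
def finiteDomain (α : ℝ) (a : Fin n → ℝ) : Set (Fin n → ℝ) :=
  {l | (∀ i, l i ≤ 1) ∧ 0 < powerSum α a l}

/-- `Λ` on its effective domain. -/
noncomputable def logMoment (α : ℝ) (a l : Fin n → ℝ) : ℝ := -(1 / α * Real.log (powerSum α a l))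

theorem powerSum_nonneg (ha : ∀ i, 0 < a i) {l : Fin n → ℝ} (hl : ∀ i, l i ≤ 1) :
    0 ≤ powerSum α a l :=
  Finset.sum_nonneg fun i _ => mul_nonneg (ha i).le (Real.rpow_nonneg (by linarith [hl i]) _)

theorem Lam_of_forall_le (hα0 : 0 < α) (hα1 : α < 1) (hsum : ∑ i, a i = 1) {l : Fin n → ℝ}
    (hl : ∀ i, l i ≤ 1) :
    Lam α a l = ((1 / α : ℝ) : EReal) * gammaCumulant ((1 - powerSum α a l : ℝ) : EReal) := by
  have hΓ : 0 < Real.Gamma (1 - α) := Real.Gamma_pos_of_pos (by linarith)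
  have h : ∑ i, (a i : EReal) * psi α (l i) =
      ((∑ i, a i * (Real.Gamma (1 - α) / α * (1 - (1 - l i) ^ α)) : ℝ) : EReal) := by
    refine Eq.trans (Finset.sum_congr rfl fun i _ => ?_)
      (map_sum (⟨⟨Real.toEReal, EReal.coe_zero⟩, EReal.coe_add⟩ : ℝ →+ EReal) _ _).symm
    rw [psi, if_pos (hl i), ← EReal.coe_mul]
    rfl
  rw [Lam, h, ← EReal.coe_mul]
  congr 3
  rw [powerSum]
  calc _ = ∑ i, a i - ∑ i, a i * (1 - l i) ^ α := by
        rw [← Finset.sum_sub_distrib, Finset.mul_sum]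
        refine Finset.sum_congr rfl fun i _ => ?_
        field_simp
    _ = _ := by rw [hsum]

theorem Lam_of_mem (hα0 : 0 < α) (hα1 : α < 1) (hsum : ∑ i, a i = 1) {l : Fin n → ℝ}
    (hl : l ∈ finiteDomain α a) : Lam α a l = (logMoment α a l : EReal) := by
  have hlt : ((1 - powerSum α a l : ℝ) : EReal) < 1 := by
    rw [← EReal.coe_one, EReal.coe_lt_coe_iff]; linarith [hl.2]
  rw [Lam_of_forall_le hα0 hα1 hsum hl.1, gammaCumulant, if_pos hlt, ← EReal.coe_mul,
    EReal.toReal_coe, sub_sub_cancel, logMoment, one_div (powerSum α a l), Real.log_inv, mul_neg]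

theorem Lam_of_powerSum_eq_zero (hα0 : 0 < α) (hα1 : α < 1) (hsum : ∑ i, a i = 1) {l : Fin n → ℝ}
    (hl : ∀ i, l i ≤ 1) (h0 : powerSum α a l = 0) : Lam α a l = ⊤ := by
  rw [Lam_of_forall_le hα0 hα1 hsum hl, h0, sub_zero, gammaCumulant, EReal.coe_one,
    if_neg (lt_irrefl _), EReal.coe_mul_top_of_pos (by positivity)]

theorem Lam_of_one_lt (hα0 : 0 < α) (hα1 : α < 1) (ha : ∀ i, 0 < a i) {l : Fin n → ℝ} {i : Fin n}
    (hi : 1 < l i) : Lam α a l = ⊤ := by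
  have hΓ : 0 < Real.Gamma (1 - α) := Real.Gamma_pos_of_pos (by linarith)
  have hbot (j : Fin n) : (a j : EReal) * psi α (l j) ≠ ⊥ := by
    rw [psi]
    split_ifs
    · rw [← EReal.coe_mul]; exact EReal.coe_ne_bot _
    · rw [EReal.coe_mul_top_of_pos (ha j)]; exact top_ne_bot
  -- In `EReal`, `⊤ + ⊥ = ⊥`, so the infinite term prevails only once the remaining sum is known not
  -- to be `⊥`.
  have hsumbot (s : Finset (Fin n)) : ∑ j ∈ s, (a j : EReal) * psi α (l j) ≠ ⊥ := by
    classical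
    induction s using Finset.induction_on with
    | empty => simp
    | insert j s hj ih =>
      rw [Finset.sum_insert hj]
      exact EReal.add_ne_bot_iff.2 ⟨hbot j, ih⟩
  have htop : ∑ j, (a j : EReal) * psi α (l j) = ⊤ := by
    classical
    rw [← Finset.add_sum_erase _ _ (Finset.mem_univ i), psi, if_neg (not_le.2 hi),
      EReal.coe_mul_top_of_pos (ha i), EReal.top_add_of_ne_bot (hsumbot _)]
  rw [Lam, htop, EReal.coe_mul_top_of_pos (by positivity), gammaCumulant,
    if_neg (not_lt.2 le_top), EReal.coe_mul_top_of_pos (by positivity)]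

theorem Lam_of_notMem (hα0 : 0 < α) (hα1 : α < 1) (ha : ∀ i, 0 < a i) (hsum : ∑ i, a i = 1)
    {l : Fin n → ℝ} (hl : l ∉ finiteDomain α a) : Lam α a l = ⊤ := by
  by_cases h1 : ∀ i, l i ≤ 1
  · refine Lam_of_powerSum_eq_zero hα0 hα1 hsum h1 (le_antisymm ?_ (powerSum_nonneg ha h1))
    exact not_lt.1 fun h => hl ⟨h1, h⟩
  · push Not at h1
    exact Lam_of_one_lt hα0 hα1 ha h1.choose_spec

/-- Off the effective domain `Λ = ⊤`, so those `l` contribute `⊥` to the supremum. -/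
theorem rateJ_eq_legendre (hα0 : 0 < α) (hα1 : α < 1) (ha : ∀ i, 0 < a i) (hsum : ∑ i, a i = 1) :
    rateJ α a = legendre (finiteDomain α a) (logMoment α a) := by
  funext y
  rw [rateJ, legendre]
  refine iSup_congr fun l => ?_
  by_cases hl : l ∈ finiteDomain α a
  · rw [Lam_of_mem hα0 hα1 hsum hl, iSup_pos hl, EReal.coe_sub]
  · rw [Lam_of_notMem hα0 hα1 ha hsum hl, iSup_neg hl, EReal.sub_top]

theorem rateJ_eq_iSup (hα0 : 0 < α) (hα1 : α < 1) (ha : ∀ i, 0 < a i) (hsum : ∑ i, a i = 1)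
    (y : Fin n → ℝ≥0) : rateJ α a y =
      ⨆ l ∈ {l : Fin n → ℝ | ∀ i, l i ≤ 1},
        ((∑ i, l i * (y i : ℝ) : ℝ) : EReal) + ((1 / α : ℝ) : EReal) *
          ENNReal.log (ENNReal.ofReal (∑ i, a i * (1 - l i) ^ α)) := by
  rw [rateJ_eq_legendre hα0 hα1 ha hsum, legendre]
  refine iSup_congr fun l => ?_
  by_cases h1 : ∀ i, l i ≤ 1
  · rw [iSup_pos (show l ∈ {l : Fin n → ℝ | ∀ i, l i ≤ 1} from h1)]
    -- The power sum vanishes only at `l = (1, …, 1)`; there `log 0 = ⊥` drops out of the supremum.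
    rcases (powerSum_nonneg (α := α) ha h1).eq_or_lt with h0 | h0
    · rw [iSup_neg fun h => h.2.ne h0]
      rw [powerSum] at h0
      rw [← h0, ENNReal.ofReal_zero, ENNReal.log_zero, EReal.coe_mul_bot_of_pos (by positivity),
        EReal.add_bot]
    · rw [iSup_pos (show l ∈ finiteDomain α a from ⟨h1, h0⟩), logMoment, sub_neg_eq_add]
      rw [powerSum] at h0 ⊢
      rw [ENNReal.log_ofReal_of_pos h0, ← EReal.coe_mul, ← EReal.coe_add]
  · rw [iSup_neg fun h => h1 h.1, iSup_neg (show l ∉ {l : Fin n → ℝ | ∀ i, l i ≤ 1} from h1)]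

theorem powerSum_pos [Nonempty (Fin n)] (ha : ∀ i, 0 < a i) {l : Fin n → ℝ} (hl : ∀ i, l i < 1) :
    0 < powerSum α a l :=
  Finset.sum_pos (fun i _ => mul_pos (ha i) (Real.rpow_pos_of_pos (by linarith [hl i]) _))
    Finset.univ_nonempty

theorem finiteDomain_mem_nhds [Nonempty (Fin n)] (ha : ∀ i, 0 < a i) {l : Fin n → ℝ}
    (hl : ∀ i, l i < 1) : finiteDomain α a ∈ 𝓝 l := by
  have h : ∀ᶠ l' in 𝓝 l, ∀ i, l' i < 1 := eventually_all.2 fun i =>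
    (continuous_apply i).continuousAt.eventually_lt continuousAt_const (hl i)
  exact h.mono fun l' hl' => ⟨fun i => (hl' i).le, powerSum_pos ha hl'⟩

theorem logMoment_zero (hsum : ∑ i, a i = 1) : logMoment α a 0 = 0 := by
  simp [logMoment, powerSum, hsum]

/-- Moving along `l = -s e_i` leaves `∑ l_j y_j = 0`, while `-Λ(l)` grows at least like `log s`. -/
theorem legendre_eq_top_of_eq_zero (hα0 : 0 < α) (ha : ∀ i, 0 < a i) {y : Fin n → ℝ≥0} {i : Fin n}
    (hi : y i = 0) : legendre (finiteDomain α a) (logMoment α a) y = ⊤ := by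
  have : Nonempty (Fin n) := ⟨i⟩
  have hlog : Tendsto (fun s : ℝ => 1 / α * Real.log (a i * (1 + s) ^ α)) atTop atTop :=
    (Real.tendsto_log_atTop.comp (((tendsto_rpow_atTop hα0).comp
      (tendsto_atTop_add_const_left _ 1 tendsto_id)).const_mul_atTop (ha i))).const_mul_atTop
      (by positivity)
  refine EReal.eq_top_iff_forall_lt _ |>.2 fun b => ?_
  obtain ⟨s, hs, hs0⟩ := ((hlog.eventually_gt_atTop b).and (eventually_gt_atTop 0)).exists
  set l : Fin n → ℝ := Pi.single i (-s) with hl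
  have hlt (j : Fin n) : l j < 1 := by
    by_cases hj : j = i
    · subst hj; simp only [hl, Pi.single_eq_same]; linarith
    · simp [hl, hj]
  have hzero : ∑ j, l j * (y j : ℝ) = 0 := by
    refine Finset.sum_eq_zero fun j _ => ?_
    by_cases hj : j = i
    · subst hj; simp [hi]
    · simp [hl, hj]
  have hge : a i * (1 + s) ^ α ≤ powerSum α a l := by
    have h1 := Finset.single_le_sum (f := fun j => a j * (1 - l j) ^ α)
      (fun j _ => mul_nonneg (ha j).le (Real.rpow_nonneg (by linarith [hlt j]) _))
      (Finset.mem_univ i)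
    simp only [hl, Pi.single_eq_same, sub_neg_eq_add] at h1
    exact h1
  have hpos : 0 < a i * (1 + s) ^ α :=
    mul_pos (ha i) (Real.rpow_pos_of_pos (by linarith) _)
  refine lt_of_lt_of_le ?_ (le_legendre (mem_of_mem_nhds (finiteDomain_mem_nhds ha hlt)) y)
  rw [EReal.coe_lt_coe_iff, hzero, logMoment, zero_sub, neg_neg]
  refine hs.trans_le ?_
  gcongr

theorem hasDerivAt_logMoment (hα0 : 0 < α) {l : Fin n → ℝ} (ha : ∀ i, 0 < a i) (hl : ∀ i, l i < 1)
    (i : Fin n) :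
    HasDerivAt (fun s : ℝ => logMoment α a (l + Pi.single i s))
      (a i * (1 - l i) ^ (α - 1) / powerSum α a l) 0 := by
  have : Nonempty (Fin n) := ⟨i⟩
  have hS : 0 < powerSum α a l := powerSum_pos ha hl
  have hterm (j : Fin n) : HasDerivAt (fun s : ℝ => a j * (1 - (l + Pi.single i s : Fin n → ℝ) j) ^ α)
      (if j = i then -(α * (a i * (1 - l i) ^ (α - 1))) else 0) 0 := by
    by_cases hj : j = i
    · subst hj
      have h1 : HasDerivAt (fun s : ℝ => 1 - (l j + s)) (-1) 0 :=
        ((hasDerivAt_id (0 : ℝ)).const_add (l j)).const_sub 1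
      have h2 := (h1.rpow_const (p := α) (Or.inl (by linarith [hl j]))).const_mul (a j)
      simp only [Pi.add_apply, Pi.single_eq_same, if_true]
      refine h2.congr_deriv ?_
      rw [add_zero]; ring
    · simp only [Pi.add_apply, Pi.single_eq_of_ne hj, if_neg hj]
      exact hasDerivAt_const _ _
  have hsum : HasDerivAt (fun s : ℝ => powerSum α a (l + Pi.single i s))
      (-(α * (a i * (1 - l i) ^ (α - 1)))) 0 := by
    have h1 := HasDerivAt.fun_sum (u := Finset.univ) fun j _ => hterm j
    rwa [Finset.sum_ite_eq' Finset.univ i, if_pos (Finset.mem_univ i)] at h1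
  have hS' : powerSum α a (l + Pi.single i 0) ≠ 0 := by
    rw [Pi.single_zero, add_zero]; exact hS.ne'
  refine ((hsum.log hS').const_mul (1 / α)).neg.congr_deriv ?_
  rw [Pi.single_zero, add_zero]
  field_simp

/-- Every point with positive coordinates is a gradient of `Λ`. -/
theorem exists_gradient_eq (hα0 : 0 < α) (hα1 : α < 1) (ha : ∀ i, 0 < a i) [Nonempty (Fin n)]
    {y : Fin n → ℝ≥0} (hy : ∀ i, 0 < y i) :
    ∃ l : Fin n → ℝ, (∀ i, l i < 1) ∧
      ∀ i, HasDerivAt (fun s : ℝ => logMoment α a (l + Pi.single i s)) (y i) 0 := by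
  have hy' (i : Fin n) : (0 : ℝ) < y i / a i := div_pos (NNReal.coe_pos.2 (hy i)) (ha i)
  -- The equation to solve is `a_i (1 - l_i)^(α-1) / S = y_i`. Its left side is homogeneous of
  -- degree `-1` in `1 - l`, so solve `q_i^(α-1) = y_i / a_i` for the direction and rescale: `1 -
  -- l_i = q_i / Q` gives `S = Q^(1-α)`.
  let q : Fin n → ℝ := fun i => (y i / a i : ℝ) ^ (α - 1)⁻¹
  have hq (i : Fin n) : 0 < q i := Real.rpow_pos_of_pos (hy' i) _
  have hqpow (i : Fin n) : q i ^ (α - 1) = y i / a i :=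
    Real.rpow_inv_rpow (hy' i).le (by linarith)
  set Q := ∑ i, a i * q i ^ α with hQ
  have hQ0 : 0 < Q := Finset.sum_pos
    (fun i _ => mul_pos (ha i) (Real.rpow_pos_of_pos (hq i) _)) Finset.univ_nonempty
  refine ⟨fun i => 1 - q i / Q, fun i => ?_, fun i => ?_⟩
  · have := div_pos (hq i) hQ0
    linarith
  · refine (hasDerivAt_logMoment hα0 ha (fun i => ?_) i).congr_deriv ?_
    · have := div_pos (hq i) hQ0
      linarith
    have hS : powerSum α a (fun i => 1 - q i / Q) = Q / Q ^ α := by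
      rw [powerSum, hQ, Finset.sum_div]
      refine Finset.sum_congr rfl fun j _ => ?_
      rw [sub_sub_cancel, Real.div_rpow (hq j).le hQ0.le, mul_div_assoc]
    have hQα := Real.rpow_pos_of_pos hQ0 α
    have := ha i
    rw [hS, sub_sub_cancel, Real.div_rpow (hq i).le hQ0.le, hqpow, Real.rpow_sub_one hQ0.ne']
    field_simp

end Rate

/-! ### The cells -/

section Cells

variable {n : ℕ} {ν : Measure unitInterval} [IsProbabilityMeasure ν] {t : Fin (n + 1) → unitInterval}

/-- Each cell contains a nonempty open interval, which is charged by full support. -/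
theorem cellMass_pos (hν : ν.support = Set.univ) (ht : StrictMono t) (i : Fin n) :
    0 < cellMass ν t i := by
  have hlt : t i.castSucc < t i.succ := ht Fin.castSucc_lt_succ
  have hsub : Ioo (t i.castSucc) (t i.succ) ⊆ cell t i := by
    rw [cell]
    split_ifs
    · exact Ioo_subset_Icc_self
    · exact Ioo_subset_Ioc_self
  obtain ⟨x, hx⟩ : (Ioo (t i.castSucc) (t i.succ)).Nonempty := exists_between hlt
  have hpos : 0 < ν (Ioo (t i.castSucc) (t i.succ)) :=
    (Measure.mem_support_iff_forall x).1 (hν ▸ mem_univ x) _ (isOpen_Ioo.mem_nhds hx)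
  exact ENNReal.toReal_pos (hpos.trans_le (measure_mono hsub)).ne' (measure_ne_top _ _)

theorem cellMass_eq_sub (hνd : ∀ x, ν {x} = 0) (ht : StrictMono t) (i : Fin n) :
    cellMass ν t i = ν.real (Iic (t i.succ)) - ν.real (Iic (t i.castSucc)) := by
  have : NullSingletonClass ν := ⟨hνd⟩
  have hle : t i.castSucc ≤ t i.succ := ht.monotone (Fin.castSucc_le_succ i)
  have h1 : cellMass ν t i = ν.real (Ioc (t i.castSucc) (t i.succ)) := by
    rw [cellMass, cell]
    split_ifs
    · exact measureReal_congr Ioc_ae_eq_Icc.symm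
    · rfl
  rw [h1, ← Iic_sdiff_Iic, measureReal_sdiff (Iic_subset_Iic.2 hle) measurableSet_Iic]

/-- The partial sums telescope to the distribution function of `ν`, which starts at `ν {0} = 0`. -/
theorem sum_cellMass (hνd : ∀ x, ν {x} = 0) (ht : StrictMono t) (ht0 : t 0 = 0)
    (ht1 : t (Fin.last n) = 1) : ∑ i, cellMass ν t i = 1 := by
  have h (k : Fin (n + 1)) : partialMass (cellMass ν t) k = ν.real (Iic (t k)) := by
    induction k using Fin.induction with
    | zero =>
      have h0 : Iic (0 : unitInterval) = {0} := Iic_bot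
      rw [partialMass_zero, ht0, h0, measureReal_def, hνd, ENNReal.toReal_zero]
    | succ i ih => rw [partialMass_succ, ih, cellMass_eq_sub hνd ht i]; ring
  have hl := h (Fin.last n)
  have htop : Iic (1 : unitInterval) = univ := Iic_top
  rw [ht1, htop, probReal_univ, partialMass] at hl
  simpa [Fin.castSucc_lt_last] using hl

end Cells

/-! ### The large deviation principle for the rescaled increments -/

theorem satisfiesLDP_rescaledIncrements {Ω : Type*} [MeasurableSpace Ω] {P : Measure Ω}
    [IsProbabilityMeasure P] {α : ℝ} (hα0 : 0 < α) (hα1 : α < 1) {σ τ : ℝ≥0 → Ω → ℝ≥0}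
    (hσ : IsSubordinator P σ (temperedStableLevy α)) (hτ : IsSubordinator P τ gammaLevy)
    (hστ : IndepFun (fun ω t => σ t ω) (fun ω t => τ t ω) P) {n : ℕ} {a : Fin n → ℝ}
    (ha : ∀ i, 0 < a i) (hsum : ∑ i, a i = 1) :
    SatisfiesLDP (fun θ : ℝ => P.map (rescaledIncrements α a σ τ θ)) (rateJ α a) := by
  -- An empty sum cannot equal `1`, so `n ≥ 1`.
  have hne : Nonempty (Fin n) := by
    by_contra hcon
    rw [not_nonempty_iff] at hcon
    simp at hsum
  rw [rateJ_eq_legendre hα0 hα1 ha hsum]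
  refine satisfiesLDP_legendre (finiteDomain_mem_nhds ha fun _ => one_pos) (logMoment_zero hsum)
    (fun θ hθ l hl => ?_) fun y hy => ?_
  · have hm : Measurable fun z : Fin n → ℝ≥0 =>
        ENNReal.ofReal (Real.exp (θ * ∑ i, l i * (z i : ℝ))) := by fun_prop
    rw [lintegral_map' hm.aemeasurable (aemeasurable_rescaledIncrements hα0 hα1 hσ hτ a θ),
      lintegral_exp_rescaledIncrements hα0 hα1 hσ hτ hστ (fun i => (ha i).le) hsum hθ hl.1 hl.2,
      ← mul_neg]
    rfl
  · have hpos (i : Fin n) : 0 < y i :=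
      pos_iff_ne_zero.2 fun h => hy (legendre_eq_top_of_eq_zero hα0 ha h)
    obtain ⟨l, hl, hd⟩ := exists_gradient_eq hα0 hα1 ha hpos
    exact ⟨l, finiteDomain_mem_nhds ha hl, hd⟩

end TwoParamDirichlet

open TwoParamDirichlet in
theorem mainTheorem5 {Ω : Type*} [MeasurableSpace Ω] (P : Measure Ω) [IsProbabilityMeasure P]
    (α : ℝ) (hα0 : 0 < α) (hα1 : α < 1)
    (σ τ : ℝ≥0 → Ω → ℝ≥0)
    (hσ : IsSubordinator P σ (temperedStableLevy α))
    (hτ : IsSubordinator P τ gammaLevy)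
    (hστ : IndepFun (fun ω t => σ t ω) (fun ω t => τ t ω) P)
    (ν : Measure unitInterval) [IsProbabilityMeasure ν] (hνd : ∀ x, ν {x} = 0) (hν : ν.support = Set.univ)
    (n : ℕ) (t : Fin (n + 1) → unitInterval) (ht : StrictMono t) (ht0 : t 0 = 0) (ht1 : t (Fin.last n) = 1) :
    -- `ψ` is the cumulant function of `σ(1)`
    (∀ l : ℝ, ENNReal.log (∫⁻ ω, ENNReal.ofReal (Real.exp (l * (σ 1 ω : ℝ))) ∂P) = psi α l) ∧
    -- `L` is the limiting cumulant function of `τ(θ)`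
    (∀ l : ℝ, Tendsto
      (fun θ : ℝ => ((1 / θ : ℝ) : EReal) *
        ENNReal.log (∫⁻ ω, ENNReal.ofReal (Real.exp (l * (τ (Real.toNNReal θ) ω : ℝ))) ∂P))
      atTop (𝓝 (gammaCumulant (l : EReal)))) ∧
    -- the large deviation principle for the laws of the rescaled increments
    (∀ θ : ℝ, 0 < θ → AEMeasurable (rescaledIncrements α (cellMass ν t) σ τ θ) P) ∧
    SatisfiesLDP (fun θ : ℝ => P.map (rescaledIncrements α (cellMass ν t) σ τ θ))
      (rateJ α (cellMass ν t)) ∧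
    -- the explicit form of the rate function
    (∀ y : Fin n → ℝ≥0, rateJ α (cellMass ν t) y =
      ⨆ l ∈ {l : Fin n → ℝ | ∀ i, l i ≤ 1},
        ((∑ i, l i * (y i : ℝ) : ℝ) : EReal) + ((1 / α : ℝ) : EReal) *
          ENNReal.log (ENNReal.ofReal (∑ i, cellMass ν t i * (1 - l i) ^ α))) := by
  have ha : ∀ i, 0 < cellMass ν t i := cellMass_pos hν ht
  have hsum : ∑ i, cellMass ν t i = 1 := sum_cellMass hνd ht ht0 ht1
  exact ⟨hσ.log_lintegral_exp_one hα0 hα1, hτ.tendsto_cumulant_gamma,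
    fun θ _ => aemeasurable_rescaledIncrements hα0 hα1 hσ hτ _ θ,
    satisfiesLDP_rescaledIncrements hα0 hα1 hσ hτ hστ ha hsum,
    rateJ_eq_iSup hα0 hα1 ha hsum⟩
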